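/- Let $\omega:[0,\infty)\to[0,\infty)$ be a convex upward (i.e. concave) modulus of continuity: $\omega(0)=0$, $\omega$ is continuous, nondecreasing, subadditive and concave. Let $H_\omega$ be the set of continuous $2\pi$-periodic $\varphi:\mathbb R\to\mathbb R$ with $|\varphi(s)-\varphi(t)|\le\omega(|s-t|)$ for all $s,t\in\mathbb R$. For $q\in(0,1)$ and $\beta\in\mathbb R$ let $C^q_\beta H_\omega$ be the set of functions $$f(x)=A_0+\frac1\pi\int_0^{2\pi}\varphi(x+t)\sum_{k=1}^\infty q^k\cos\Big(kt+\frac{\beta\pi}2\Big)\,dt,\qquad A_0\in\mathbb R,\ \varphi\in H_\omega .$$ For $n,p\in\mathbb N$, $1\le p<n$, let $V_{n,p}(f;x)=\frac1p\sum_{k=n-p}^{n-1}S_k(f;x)$, where $S_k(f;\cdot)$ is the $k$-th partial sum of the Fourier series of $f$, and let $$\mathcal E(C^q_\beta H_\omega;V_{n,p})=\sup_{f\in C^q_\beta H_\omega}\ \max_{x\in\mathbb R}|f(x)-V_{n,p}(f;x)| .$$ Put $$K_{p,q}=\int_0^{2\pi}\frac{\sqrt{1-2q^p\cos pt+q^{2p}}}{1-2q\cos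 t+q^2}\,dt,\qquad e_m(\omega)=\int_0^{\pi/2}\omega\Big(\frac{2t}{m}\Big)\sin t\,dt,$$ and $\delta(1)=2$, $\delta(p)=3$ for $p\ge2$. **Theorem 1.** (i) There is an absolute constant $C$ such that for all $q\in(0,1)$, $\beta\in\mathbb R$, $n,p\in\mathbb N$ with $1\le p<n$, and all convex upward moduli of continuity $\omega$, the quantity $\mathcal E(C^q_\beta H_\omega;V_{n,p})$ is finite and $$\mathcal E(C^q_\beta H_\omega;V_{n,p})=\frac{q^{n-p+1}}{p}\Big(\frac{K_{p,q}}{\pi^2}\,e_{n-p+1}(\omega)+\gamma\,\frac{\omega(\pi)}{(1-q)^{\delta(p)}(n-p+1)}\Big)\quad\text{with } |\gamma|\le C .$$ (ii) Let $q\in(0,1)$, $\beta\in\mathbb R$ and a convex upward modulus of continuity $\omega\not\equiv0$ be fixed, and let $(n_k)$, $(p_k)$ be sequences of integers with $1\le p_k<n_k$ and $n_k-p_k\to\infty$. The formula in (i) is an asymptotic equality, in the sense that along $(n,p)=(n_k,p_k)$ its remainder term is negligible with respect to its principal term, $$\frac{\omega(\pi)}{(1-q)^{\delta(p)}(n-p+1)}=o\Big(\frac{K_{p,q}}{\pi^2}\,e_{n-p+1}(\omega)\Big),$$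 if and only if $\lim_{t\to0+}\omega(t)/t=\infty$. In that case $$\mathcal E(C^q_\beta H_\omega;V_{n,p})\sim\frac{q^{n-p+1}}{p}\,\frac{K_{p,q}}{\pi^2}\,e_{n-p+1}(\omega).$$ -/

import Mathlib

open Real Set Filter Topology MeasureTheory
open scoped ENNReal Asymptotics

noncomputable section

namespace PoissonVP

/-- Modulus of continuity on `[0, ∞)`: `ω(0) = 0`, continuous, nondecreasing and subadditive.
Only the values of `ω` on `[0, ∞)` are ever used. -/
structure IsModulusOfContinuity (ω : ℝ → ℝ) : Prop where
  zero : ω 0 = 0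
  continuousOn : ContinuousOn ω (Ici 0)
  monotoneOn : MonotoneOn ω (Ici 0)
  subadditive : ∀ s t : ℝ, 0 ≤ s → 0 ≤ t → ω (s + t) ≤ ω s + ω t

/-- A convex upwards (i.e. concave) modulus of continuity. -/
structure IsConvexUpwardModulus (ω : ℝ → ℝ) : Prop extends IsModulusOfContinuity ω where
  concaveOn : ConcaveOn ℝ (Ici 0) ω

/-- The class `H_ω` of continuous `2π`-periodic functions with
`|φ(s) - φ(t)| ≤ ω(|s - t|)` for all real `s, t`. -/
def classH (ω : ℝ → ℝ) : Set (ℝ → ℝ) :=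
  {φ | Continuous φ ∧ Function.Periodic φ (2 * π) ∧ ∀ s t : ℝ, |φ s - φ t| ≤ ω |s - t|}

/-- The Poisson kernel `P_{q,β}(t) = ∑_{k ≥ 1} q^k cos(kt + βπ/2)`. -/
def poissonKernel (q β t : ℝ) : ℝ :=
  ∑' k : ℕ, q ^ (k + 1) * cos (((k + 1 : ℕ) : ℝ) * t + β * π / 2)

/-- The class `C^q_β 𝔑` of Poisson integrals of the functions of `𝔑`. -/
def poissonClass (q β : ℝ) (N : Set (ℝ → ℝ)) : Set (ℝ → ℝ) :=
  {f | ∃ A₀ : ℝ, ∃ φ ∈ N, ∀ x : ℝ,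
    f x = A₀ + 1 / π * ∫ t in (0 : ℝ)..(2 * π), φ (x + t) * poissonKernel q β t}

/-- Cosine Fourier coefficient `a_j(f)`. -/
def fourierCos (f : ℝ → ℝ) (j : ℕ) : ℝ :=
  1 / π * ∫ t in (-π)..π, f t * cos (j * t)

/-- Sine Fourier coefficient `b_j(f)`. -/
def fourierSin (f : ℝ → ℝ) (j : ℕ) : ℝ :=
  1 / π * ∫ t in (-π)..π, f t * sin (j * t)

/-- The partial sum `S_k(f; x)` of the Fourier series of `f`. -/
def fourierSum (k : ℕ) (f : ℝ → ℝ) (x : ℝ) : ℝ :=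
  fourierCos f 0 / 2 +
    ∑ j ∈ Finset.Icc 1 k, (fourierCos f j * cos (j * x) + fourierSin f j * sin (j * x))

/-- The de la Vallée Poussin sum `V_{n,p}(f; x) = (1/p) ∑_{k=n-p}^{n-1} S_k(f; x)`. -/
def valleePoussin (n p : ℕ) (f : ℝ → ℝ) (x : ℝ) : ℝ :=
  1 / (p : ℝ) * ∑ k ∈ Finset.Ico (n - p) n, fourierSum k f x

/-- The uniform norm `sup_x |g(x)|`, with values in `[0, ∞]`. -/
def uniformNorm (g : ℝ → ℝ) : ℝ≥0∞ := ⨆ x : ℝ, ‖g x‖ₑ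

/-- `𝓔(𝔑; V_{n,p})`, the supremum over `f ∈ 𝔑` of the uniform norm of `f - V_{n,p}(f)`,
with values in `[0, ∞]`. -/
def deviation (N : Set (ℝ → ℝ)) (n p : ℕ) : ℝ≥0∞ :=
  ⨆ f ∈ N, uniformNorm (fun x => f x - valleePoussin n p f x)

/-- `K_{p,q} = ∫_0^{2π} √(1 - 2 q^p cos pt + q^{2p}) / (1 - 2 q cos t + q²) dt`. -/
def constK (p : ℕ) (q : ℝ) : ℝ :=
  ∫ t in (0 : ℝ)..(2 * π),
    √(1 - 2 * q ^ p * cos (p * t) + q ^ (2 * p)) / (1 - 2 * q * cos t + q ^ 2)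

/-- `e_m(ω) = ∫_0^{π/2} ω(2t/m) sin t dt`. -/
def modulusE (m : ℕ) (ω : ℝ → ℝ) : ℝ :=
  ∫ t in (0 : ℝ)..(π / 2), ω (2 * t / m) * sin t

/-- `δ(1) = 2` and `δ(p) = 3` for `p ≥ 2`. -/
def expDelta (p : ℕ) : ℕ := if p = 1 then 2 else 3

/-- The bracketed principal term `K_{p,q} / π² · e_{n-p+1}(ω)`. -/
def principalTerm (q : ℝ) (ω : ℝ → ℝ) (n p : ℕ) : ℝ :=
  constK p q / π ^ 2 * modulusE (n - p + 1) ω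

/-- The bracketed remainder bound `ω(π) / ((1 - q)^{δ(p)} (n - p + 1))`. -/
def remainderTerm (q : ℝ) (ω : ℝ → ℝ) (n p : ℕ) : ℝ :=
  ω π / ((1 - q) ^ expDelta p * ((n - p + 1 : ℕ) : ℝ))

end PoissonVP

end

open PoissonVP

/-! ### Concave moduli and the extremal triangular wave. -/

namespace PoissonVP

variable {ω : ℝ → ℝ}

/-! Put z = q e^{it}, M = n - p + 1. The tails of the Poisson kernel are geometric, so averaging p
of them gives the kernel z^M (1 - z^p)/(1 - z)^2, up to a rotation and the factor 1/p. Hence f -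
V_{n,p}(f) is q^M/(pπ) times the integral of φ(x+t) r(t) cos(Mt + θ(t)), where r and θ are the
modulus and argument of the rotated factor (1 - z^p)/(1 - z)^2 (`sub_valleePoussin`). The integral
of r is K_{p,q}, and r, r', θ' are bounded independently of n; the bound 3/(1-q) on the logarithmic
derivative does not depend on p either.

What remains concerns a slowly varying amplitude r and phase θ: the supremum over H_ω of the
integral of φ r cos(Mt + θ) is (∫r) e_M(ω)/π, up to O(ω(π)/M).

Upper bound (`abs_integral_le_of_mem_classH`): cut the period where the phase is a multiple of π. On
each arc freeze r and linearise the phase. Pairing points symmetric about the midpoint of an arc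
bounds the half wave by e_M(ω). The errors are quadratic in the arc length, so they sum to O(1/M).

Lower bound (`exists_mem_classH_integral_ge`): take φ to be the odd function ±ω(2|·|)/2 evaluated
along a triangular wave in the phase, slightly shrunk. Concavity of ω puts it in H_ω. Its product
with the cosine is a π-periodic function of the phase with mean e_M(ω)/π, and integration by parts
replaces it by that mean.

For the asymptotic criterion, K_{p,q} lies between positive bounds depending on q alone, so the
question is whether M e_M(ω) → ∞. As ω(t)/t is nonincreasing, it either tends to infinity at 0 or is
bounded, and e_M(ω) is then compared with its value for a linear ω. -/

lemma IsModulusOfContinuity.mono (h : IsModulusOfContinuity ω) {s t : ℝ} (hs : 0 ≤ s)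
    (hst : s ≤ t) : ω s ≤ ω t :=
  h.monotoneOn (mem_Ici.2 hs) (mem_Ici.2 (hs.trans hst)) hst

lemma IsModulusOfContinuity.nonneg (h : IsModulusOfContinuity ω) {t : ℝ} (ht : 0 ≤ t) :
    0 ≤ ω t := by
  simpa [h.zero] using h.mono le_rfl ht

lemma IsModulusOfContinuity.continuous_comp_max (h : IsModulusOfContinuity ω) :
    Continuous fun x => ω (max x 0) :=
  h.continuousOn.comp_continuous (by fun_prop) fun x => mem_Ici.2 (le_max_right x 0)

/-- Concavity on the segment from 0 to `c * x`, with ω(0) = 0. It turns an excess in a Lipschitz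
constant into the same factor in front of ω. -/
lemma IsConvexUpwardModulus.mul_le (h : IsConvexUpwardModulus ω) {c x : ℝ} (hc : 1 ≤ c)
    (hx : 0 ≤ x) : ω (c * x) ≤ c * ω x := by
  have hc0 : 0 < c := by linarith
  have h1 : (1 / c : ℝ) ≤ 1 := by rw [div_le_one hc0]; exact hc
  have := h.concaveOn.2 (mem_Ici.2 (mul_nonneg hc0.le hx)) (mem_Ici.2 (le_refl (0 : ℝ)))
    (one_div_nonneg.2 hc0.le) (sub_nonneg.2 h1) (by ring)
  simp only [smul_eq_mul, mul_zero, add_zero, h.zero] at this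
  rw [← mul_assoc, one_div_mul_cancel hc0.ne', one_mul, one_div, inv_mul_le_iff₀ hc0] at this
  exact this

lemma IsConvexUpwardModulus.add_le_two_mul (h : IsConvexUpwardModulus ω) {a b : ℝ} (ha : 0 ≤ a)
    (hb : 0 ≤ b) : ω a + ω b ≤ 2 * ω ((a + b) / 2) := by
  have := h.concaveOn.2 (mem_Ici.2 ha) (mem_Ici.2 hb) (by norm_num : (0 : ℝ) ≤ 1 / 2)
    (by norm_num : (0 : ℝ) ≤ 1 / 2) (by norm_num)
  simp only [smul_eq_mul] at this
  rw [show (1 / 2 * a + 1 / 2 * b : ℝ) = (a + b) / 2 by ring] at this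
  linarith

/-- The odd function equal to `ω (2 x) / 2` for `x ≥ 0`. -/
noncomputable def oddHalf (ω : ℝ → ℝ) (x : ℝ) : ℝ :=
  (ω (max (2 * x) 0) - ω (max (-(2 * x)) 0)) / 2

lemma oddHalf_neg (ω : ℝ → ℝ) (x : ℝ) : oddHalf ω (-x) = -oddHalf ω x := by
  unfold oddHalf; rw [mul_neg, neg_neg]; ring

lemma oddHalf_of_nonneg (h : IsModulusOfContinuity ω) {x : ℝ} (hx : 0 ≤ x) :
    oddHalf ω x = ω (2 * x) / 2 := by
  unfold oddHalf
  rw [max_eq_left (by linarith), max_eq_right (by linarith), h.zero, sub_zero]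

lemma continuous_oddHalf (h : IsModulusOfContinuity ω) : Continuous (oddHalf ω) := by
  have h1 := h.continuous_comp_max
  unfold oddHalf
  exact ((h1.comp (by fun_prop : Continuous fun x : ℝ => 2 * x)).sub
    (h1.comp (by fun_prop : Continuous fun x : ℝ => -(2 * x)))).div_const 2

/-- For points of the same sign, subadditivity used twice gives ω(2d) ≤ 2ω(d), which the factor 1/2
absorbs. For opposite signs, concavity at the midpoint of 2x and -2y is what is needed. -/
lemma abs_oddHalf_sub_le (h : IsConvexUpwardModulus ω) (x y : ℝ) :
    |oddHalf ω x - oddHalf ω y| ≤ ω |x - y| := by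
  have hm := h.toIsModulusOfContinuity
  have key : ∀ x y : ℝ, 0 ≤ y → y ≤ x → |oddHalf ω x - oddHalf ω y| ≤ ω |x - y| := by
    intro x y hy hxy
    rw [oddHalf_of_nonneg hm hy, oddHalf_of_nonneg hm (hy.trans hxy),
      abs_of_nonneg (sub_nonneg.2 hxy)]
    have h1 := hm.mono (by linarith : 0 ≤ 2 * y) (by linarith : 2 * y ≤ 2 * x)
    have h2 := hm.subadditive (2 * y) (2 * (x - y)) (by linarith) (by linarith)
    have h3 := hm.subadditive (x - y) (x - y) (by linarith) (by linarith)
    rw [show 2 * y + 2 * (x - y) = 2 * x by ring] at h2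
    rw [show x - y + (x - y) = 2 * (x - y) by ring] at h3
    rw [abs_of_nonneg (by linarith)]
    linarith
  wlog hxy : y ≤ x generalizing x y
  · rw [abs_sub_comm, abs_sub_comm x y]
    exact this y x (le_of_not_ge hxy)
  rcases le_total 0 y with hy | hy
  · exact key x y hy hxy
  rcases le_total 0 x with hx | hx
  · have e1 : oddHalf ω y = -(ω (2 * (-y)) / 2) := by
      rw [← oddHalf_of_nonneg hm (by linarith : 0 ≤ -y), oddHalf_neg, neg_neg]
    have h1 := h.add_le_two_mul (by linarith : 0 ≤ 2 * x) (by linarith : 0 ≤ 2 * (-y))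
    have h2 := hm.nonneg (by linarith : 0 ≤ 2 * x)
    have h3 := hm.nonneg (by linarith : 0 ≤ 2 * (-y))
    rw [e1, oddHalf_of_nonneg hm hx, abs_of_nonneg (by linarith), abs_of_nonneg (by linarith),
      show x - y = (2 * x + 2 * (-y)) / 2 by ring]
    linarith
  · have := key (-y) (-x) (by linarith) (by linarith)
    rw [oddHalf_neg, oddHalf_neg] at this
    convert this using 2 <;> ring_nf

lemma abs_oddHalf_le (h : IsConvexUpwardModulus ω) (x : ℝ) : |oddHalf ω x| ≤ ω |x| := by
  simpa [oddHalf] using abs_oddHalf_sub_le h x 0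

lemma arccos_cos_le_abs (x : ℝ) : arccos (cos x) ≤ |x| := by
  rcases le_total |x| π with hx | hx
  · rw [← cos_abs, arccos_cos (abs_nonneg x) hx]
  · exact (arccos_le_pi _).trans hx

/-- arccos(cos x) is the distance from x to 2πℤ, hence 1-Lipschitz. The multiple nearest to y
attains the distance for y and bounds it from above for x. -/
lemma abs_arcsin_cos_sub_le (x y : ℝ) : |arcsin (cos x) - arcsin (cos y)| ≤ |x - y| := by
  have key : ∀ x y : ℝ, arccos (cos x) - arccos (cos y) ≤ |x - y| := by
    intro x y
    obtain ⟨k, hk⟩ : ∃ k : ℤ, |y - k * (2 * π)| ≤ π := by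
      refine ⟨round (y / (2 * π)), ?_⟩
      have h := abs_sub_round (y / (2 * π))
      have hp : (0 : ℝ) < 2 * π := by positivity
      have : y - round (y / (2 * π)) * (2 * π) = (y / (2 * π) - round (y / (2 * π))) * (2 * π) := by
        field_simp
      rw [this, abs_mul, abs_of_pos hp]
      nlinarith
    have h1 : arccos (cos y) = |y - k * (2 * π)| := by
      rw [← cos_sub_int_mul_two_pi y k, ← cos_abs, arccos_cos (abs_nonneg _) hk]
    have h2 : arccos (cos x) ≤ |x - k * (2 * π)| := by
      rw [← cos_sub_int_mul_two_pi x k]; exact arccos_cos_le_abs _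
    have h3 := abs_add_le (x - y) (y - k * (2 * π))
    rw [show x - y + (y - k * (2 * π)) = x - k * (2 * π) by ring] at h3
    linarith
  rw [arcsin_eq_pi_div_two_sub_arccos, arcsin_eq_pi_div_two_sub_arccos, abs_le]
  have h1 := key x y
  have h2 := key y x
  rw [abs_sub_comm] at h2
  constructor <;> linarith

lemma continuous_modulusE_integrand (h : IsModulusOfContinuity ω) (m : ℕ) :
    Continuous fun t : ℝ => ω (max (2 * t / m) 0) * sin t :=
  (h.continuous_comp_max.comp (by fun_prop : Continuous fun t : ℝ => 2 * t / m)).mul continuous_sin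

/-- The truncation by `max` makes the integrand continuous on all of ℝ, since ω is uncontrolled on
the negative axis. -/
lemma modulusE_eq (ω : ℝ → ℝ) (m : ℕ) :
    modulusE m ω = ∫ t in (0 : ℝ)..(π / 2), ω (max (2 * t / m) 0) * sin t := by
  unfold modulusE
  refine intervalIntegral.integral_congr fun t ht => ?_
  rw [uIcc_of_le (by positivity)] at ht
  have : 0 ≤ 2 * t / m := div_nonneg (by linarith [ht.1]) (Nat.cast_nonneg m)
  simp only [max_eq_left this]

lemma modulusE_nonneg (h : IsModulusOfContinuity ω) (m : ℕ) : 0 ≤ modulusE m ω := by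
  rw [modulusE_eq]
  refine intervalIntegral.integral_nonneg (by positivity) fun t ht => ?_
  exact mul_nonneg (h.nonneg (le_max_right _ _))
    (sin_nonneg_of_nonneg_of_le_pi ht.1 (by linarith [ht.2, pi_pos]))

lemma modulusE_le (h : IsModulusOfContinuity ω) {m : ℕ} (hm : 0 < m) : modulusE m ω ≤ ω π := by
  rw [modulusE_eq]
  have hm1 : (1 : ℝ) ≤ m := by exact_mod_cast hm
  have h1 : ∫ t in (0 : ℝ)..(π / 2), ω π * sin t = ω π := by
    rw [intervalIntegral.integral_const_mul, integral_sin]; simp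
  rw [← h1]
  refine intervalIntegral.integral_mono_on (by positivity)
    ((continuous_modulusE_integrand h m).intervalIntegrable _ _)
    ((by fun_prop : Continuous fun t => ω π * sin t).intervalIntegrable _ _) fun t ht => ?_
  refine mul_le_mul_of_nonneg_right (h.mono (le_max_right _ _) (max_le ?_ pi_pos.le))
    (sin_nonneg_of_nonneg_of_le_pi ht.1 (by linarith [ht.2, pi_pos]))
  rw [div_le_iff₀ (by linarith)]
  nlinarith [ht.2, pi_pos]

/-- The `π`-periodic product of `cos` and the extremal triangular wave. -/
noncomputable def waveCos (ω : ℝ → ℝ) (m : ℕ) (x : ℝ) : ℝ :=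
  oddHalf ω (arcsin (cos x) / m) * cos x

lemma continuous_waveCos (h : IsModulusOfContinuity ω) (m : ℕ) : Continuous (waveCos ω m) :=
  ((continuous_oddHalf h).comp ((continuous_arcsin.comp continuous_cos).div_const _)).mul
    continuous_cos

lemma periodic_waveCos (ω : ℝ → ℝ) (m : ℕ) : Function.Periodic (waveCos ω m) π := by
  intro x
  unfold waveCos
  rw [cos_add_pi, arcsin_neg, neg_div, oddHalf_neg]
  ring

lemma abs_waveCos_le (h : IsConvexUpwardModulus ω) {m : ℕ} (hm : 0 < m) (x : ℝ) :
    |waveCos ω m x| ≤ ω π := by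
  have hm1 : (1 : ℝ) ≤ m := by exact_mod_cast hm
  unfold waveCos
  rw [abs_mul]
  have h1 : |arcsin (cos x) / m| ≤ π := by
    rw [abs_div, abs_of_pos (by linarith : (0 : ℝ) < m), div_le_iff₀ (by linarith)]
    have : |arcsin (cos x)| ≤ π / 2 :=
      abs_le.2 ⟨neg_pi_div_two_le_arcsin _, arcsin_le_pi_div_two _⟩
    nlinarith [pi_pos]
  have h2 := (abs_oddHalf_le h (arcsin (cos x) / m)).trans
    (h.toIsModulusOfContinuity.mono (abs_nonneg _) h1)
  calc _ ≤ ω π * 1 := mul_le_mul h2 (abs_cos_le_one x) (abs_nonneg _)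
        (h.toIsModulusOfContinuity.nonneg pi_pos.le)
    _ = ω π := mul_one _

/-- The substitution x ↦ π/2 - x straightens arcsin(cos x) into x; the integrand becomes even, and
doubling cancels the 1/2 in `oddHalf`. -/
lemma integral_waveCos (h : IsModulusOfContinuity ω) (m : ℕ) :
    ∫ x in (0 : ℝ)..π, waveCos ω m x = modulusE m ω := by
  set f : ℝ → ℝ := fun y => oddHalf ω (y / m) * sin y with hf
  have hfc : Continuous f :=
    ((continuous_oddHalf h).comp (continuous_id.div_const _)).mul continuous_sin
  have h1 : ∫ x in (0 : ℝ)..π, waveCos ω m x = ∫ x in (0 : ℝ)..π, f (π / 2 - x) := by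
    refine intervalIntegral.integral_congr fun x hx => ?_
    rw [uIcc_of_le pi_pos.le] at hx
    simp only [hf, waveCos, sin_pi_div_two_sub, arcsin_eq_pi_div_two_sub_arccos,
      arccos_cos hx.1 hx.2]
  have h2 : ∫ x in (-(π / 2))..0, f x = ∫ x in (0 : ℝ)..(π / 2), f x := by
    rw [← neg_zero, ← intervalIntegral.integral_comp_neg, neg_zero]
    refine intervalIntegral.integral_congr fun x _ => ?_
    simp only [hf, sin_neg, neg_div, oddHalf_neg]
    ring
  rw [h1, intervalIntegral.integral_comp_sub_left, show π / 2 - π = -(π / 2) by ring, sub_zero,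
    ← intervalIntegral.integral_add_adjacent_intervals (hfc.intervalIntegrable _ 0)
      (hfc.intervalIntegrable _ _), h2, ← two_mul, ← intervalIntegral.integral_const_mul]
  unfold modulusE
  refine intervalIntegral.integral_congr fun t ht => ?_
  rw [uIcc_of_le (by positivity)] at ht
  simp only [hf]
  rw [oddHalf_of_nonneg h (div_nonneg ht.1 (Nat.cast_nonneg m)), mul_div_assoc]
  ring

end PoissonVP

/-! ### Oscillatory integrals over H_ω: the extremal function and the lower bound. -/

namespace PoissonVP

variable {ω : ℝ → ℝ}

lemma abs_sub_le_of_hasDerivAt {f f' : ℝ → ℝ} {C : ℝ} (hf : ∀ t, HasDerivAt f (f' t) t)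
    (hC : ∀ t, |f' t| ≤ C) (s t : ℝ) : |f s - f t| ≤ C * |s - t| := by
  have := Convex.norm_image_sub_le_of_norm_hasDerivWithin_le (f := f) (f' := f') (s := univ)
    (C := C) (fun x _ => (hf x).hasDerivWithinAt) (fun x _ => hC x) convex_univ
    (mem_univ t) (mem_univ s)
  simpa using this

lemma abs_integral_le_of_abs_le {f : ℝ → ℝ} {C : ℝ} (hf : ∀ t, |f t| ≤ C) :
    |∫ t in (0 : ℝ)..(2 * π), f t| ≤ C * (2 * π) := by
  have := intervalIntegral.norm_integral_le_of_norm_le_const (a := 0) (b := 2 * π) (f := f)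
    fun t _ => hf t
  rwa [sub_zero, abs_of_pos (by positivity : (0 : ℝ) < 2 * π)] at this

/-- A primitive of a continuous periodic function of mean zero is bounded. -/
lemma exists_periodic_primitive {F : ℝ → ℝ} {T C : ℝ} (hT : 0 < T) (hF : Continuous F)
    (hper : Function.Periodic F T) (hC : ∀ x, |F x| ≤ C) (hmean : ∫ x in (0 : ℝ)..T, F x = 0) :
    ∃ G : ℝ → ℝ, (∀ x, HasDerivAt G (F x) x) ∧ Function.Periodic G T ∧ ∀ x, |G x| ≤ C * T := by
  have hper' : Function.Periodic (fun x => ∫ s in (0 : ℝ)..x, F s) T := by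
    intro x
    have h1 := intervalIntegral.integral_add_adjacent_intervals (hF.intervalIntegrable 0 x)
      (hF.intervalIntegrable (μ := volume) x (x + T))
    have h2 := hper.intervalIntegral_add_eq x 0
    rw [zero_add, hmean] at h2
    rw [h2, add_zero] at h1
    exact h1.symm
  refine ⟨fun x => ∫ s in (0 : ℝ)..x, F s, fun x => hF.integral_hasStrictDerivAt 0 x |>.hasDerivAt,
    hper', fun x => ?_⟩
  obtain ⟨y, hy, hxy⟩ := hper'.exists_mem_Ico₀ hT x
  change |∫ s in (0 : ℝ)..x, F s| ≤ _
  rw [hxy]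
  have h1 := intervalIntegral.norm_integral_le_of_norm_le_const (a := 0) (b := y) (f := F)
    fun t _ => hC t
  rw [sub_zero, abs_of_nonneg hy.1] at h1
  exact h1.trans (mul_le_mul_of_nonneg_left hy.2.le ((abs_nonneg _).trans (hC 0)))

/-- A periodic amplitude integrated against a rapidly oscillating mean-zero periodic function. -/
lemma abs_integral_comp_phase_le {F r r' θ θ' : ℝ → ℝ} {B B' E C : ℝ} {M : ℕ} (hM : 0 < M)
    (hF : Continuous F) (hper : Function.Periodic F π) (hC : ∀ x, |F x| ≤ C)
    (hmean : ∫ x in (0 : ℝ)..π, F x = 0)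
    (hr : ∀ t, HasDerivAt r (r' t) t) (hr'c : Continuous r')
    (hθ : ∀ t, HasDerivAt θ (θ' t) t) (hθ'c : Continuous θ')
    (hrp : Function.Periodic r (2 * π)) (hθp : Function.Periodic θ (2 * π))
    (hrB : ∀ t, |r t| ≤ B) (hr'B : ∀ t, |r' t| ≤ B') (hθ'E : ∀ t, |θ' t| ≤ E) :
    |∫ t in (0 : ℝ)..(2 * π), F (M * t + θ t) * r t| ≤ 40 * C * (B' + B * E) / M := by
  obtain ⟨G, hG, hGp, hGC⟩ := exists_periodic_primitive pi_pos hF hper hC hmean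
  have hM' : (0 : ℝ) < M := by exact_mod_cast hM
  have hC0 : 0 ≤ C := (abs_nonneg _).trans (hC 0)
  have hB0 : 0 ≤ B := (abs_nonneg _).trans (hrB 0)
  have hB0' : 0 ≤ B' := (abs_nonneg _).trans (hr'B 0)
  have hE0 : 0 ≤ E := (abs_nonneg _).trans (hθ'E 0)
  have hrc : Continuous r := continuous_iff_continuousAt.2 fun t => (hr t).continuousAt
  have hθc : Continuous θ := continuous_iff_continuousAt.2 fun t => (hθ t).continuousAt
  have hψ : ∀ t, HasDerivAt (fun t => M * t + θ t) (M + θ' t) t := fun t =>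
    (by simpa using (hasDerivAt_id t).const_mul (M : ℝ) : HasDerivAt (fun t : ℝ => M * t) (M : ℝ) t).add
      (hθ t)
  have hv : ∀ t, HasDerivAt (fun t => G (M * t + θ t)) (F (M * t + θ t) * (M + θ' t)) t :=
    fun t => (hG _).comp t (hψ t)
  have hFψ : Continuous fun t => F (M * t + θ t) := hF.comp (by fun_prop)
  have hparts := intervalIntegral.integral_mul_deriv_eq_deriv_mul (a := 0) (b := 2 * π)
    (fun t _ => hr t) (fun t _ => hv t) (hr'c.intervalIntegrable _ _)
    ((hFψ.mul (by fun_prop)).intervalIntegrable _ _)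
  have hbd : G (M * (2 * π) + θ (2 * π)) = G (M * 0 + θ 0) := by
    have h1 : θ (2 * π) = θ 0 := by simpa using hθp 0
    rw [h1, show (M : ℝ) * (2 * π) + θ 0 = (M * 0 + θ 0) + ((2 * M : ℕ) : ℝ) * π by
      push_cast; ring]
    exact hGp.nat_mul (2 * M) _
  have hrb : r (2 * π) = r 0 := by simpa using hrp 0
  rw [hbd, hrb, sub_self, zero_sub] at hparts
  -- The phase has derivative M + θ', so M·F(phase) is the derivative of G(phase) minus F(phase)·θ'.
  -- The first term was integrated by parts, with no boundary term by periodicity.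
  have hsplit : (M : ℝ) * ∫ t in (0 : ℝ)..(2 * π), F (M * t + θ t) * r t
      = -(∫ t in (0 : ℝ)..(2 * π), r' t * G (M * t + θ t))
        - ∫ t in (0 : ℝ)..(2 * π), F (M * t + θ t) * θ' t * r t := by
    rw [← hparts, ← intervalIntegral.integral_sub, ← intervalIntegral.integral_const_mul]
    · refine intervalIntegral.integral_congr fun t _ => ?_
      ring
    · exact (hrc.mul (hFψ.mul (by fun_prop))).intervalIntegrable _ _
    · exact ((hFψ.mul hθ'c).mul hrc).intervalIntegrable _ _
  have b1 : |∫ t in (0 : ℝ)..(2 * π), r' t * G (M * t + θ t)| ≤ B' * (C * π) * (2 * π) :=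
    abs_integral_le_of_abs_le fun t => by
      rw [abs_mul]
      exact mul_le_mul (hr'B t) (hGC _) (abs_nonneg _) hB0'
  have b2 : |∫ t in (0 : ℝ)..(2 * π), F (M * t + θ t) * θ' t * r t| ≤ C * E * B * (2 * π) :=
    abs_integral_le_of_abs_le fun t => by
      rw [abs_mul, abs_mul]
      exact mul_le_mul (mul_le_mul (hC _) (hθ'E t) (abs_nonneg _) hC0) (hrB t) (abs_nonneg _)
        (mul_nonneg hC0 hE0)
  rw [le_div_iff₀ hM', mul_comm, ← abs_of_pos hM', ← abs_mul, abs_of_pos hM', hsplit]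
  refine (abs_sub _ _).trans ?_
  rw [abs_neg]
  have hp : π * (2 * π) ≤ 40 := by nlinarith [pi_lt_four, pi_pos]
  have hp2 : 2 * π ≤ 40 := by linarith [pi_lt_four]
  have t1 : B' * (C * π) * (2 * π) ≤ C * B' * 40 := by
    calc _ = C * B' * (π * (2 * π)) := by ring
      _ ≤ _ := mul_le_mul_of_nonneg_left hp (by positivity)
  have t2 : C * E * B * (2 * π) ≤ C * E * B * 40 :=
    mul_le_mul_of_nonneg_left hp2 (by positivity)
  linarith

/-- The witness times the cosine is `waveCos` of the phase up to a constant factor. Its mean e/π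
gives the main term, and the oscillation about the mean contributes only O(1/M). -/
lemma exists_mem_classH_integral_ge (h : IsConvexUpwardModulus ω) {r r' θ θ' : ℝ → ℝ}
    {B B' E : ℝ} {M : ℕ} (hM : 0 < M)
    (hr : ∀ t, HasDerivAt r (r' t) t) (hr'c : Continuous r')
    (hθ : ∀ t, HasDerivAt θ (θ' t) t) (hθ'c : Continuous θ')
    (hrp : Function.Periodic r (2 * π)) (hθp : Function.Periodic θ (2 * π))
    (hr0 : ∀ t, 0 ≤ r t)
    (hrB : ∀ t, |r t| ≤ B) (hr'B : ∀ t, |r' t| ≤ B') (hθ'E : ∀ t, |θ' t| ≤ E) :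
    ∃ φ ∈ classH ω, (∫ t in (0 : ℝ)..(2 * π), r t) * (modulusE M ω / π)
        - 100 * ω π * (B' + B * E) / M
      ≤ ∫ t in (0 : ℝ)..(2 * π), φ t * (r t * cos (M * t + θ t)) := by
  have hm := h.toIsModulusOfContinuity
  have hM' : (0 : ℝ) < M := by exact_mod_cast hM
  have hB0 : 0 ≤ B := (abs_nonneg _).trans (hrB 0)
  have hB0' : 0 ≤ B' := (abs_nonneg _).trans (hr'B 0)
  have hE0 : 0 ≤ E := (abs_nonneg _).trans (hθ'E 0)
  have hrc : Continuous r := continuous_iff_continuousAt.2 fun t => (hr t).continuousAt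
  have hθc : Continuous θ := continuous_iff_continuousAt.2 fun t => (hθ t).continuousAt
  have hωπ : 0 ≤ ω π := hm.nonneg pi_pos.le
  -- The phase is Lipschitz with constant M + E = lam·M. Dividing the witness by lam keeps it in
  -- H_ω, at a relative cost of at most E/M.
  set lam : ℝ := 1 + E / M with hlam
  have hlam1 : 1 ≤ lam := by rw [hlam]; linarith [div_nonneg hE0 hM'.le]
  have hlam0 : 0 < lam := by linarith
  set e := modulusE M ω with he
  have he0 : 0 ≤ e := modulusE_nonneg hm M
  have heω : e ≤ ω π := modulusE_le hm hM
  set K := ∫ t in (0 : ℝ)..(2 * π), r t with hK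
  have hK0 : 0 ≤ K := intervalIntegral.integral_nonneg (by positivity) fun t _ => hr0 t
  have hKB : K ≤ B * (2 * π) := (le_abs_self _).trans (abs_integral_le_of_abs_le hrB)
  have hθlip := abs_sub_le_of_hasDerivAt hθ hθ'E
  refine ⟨fun t => 1 / lam * oddHalf ω (arcsin (cos (M * t + θ t)) / M), ⟨?_, ?_, ?_⟩, ?_⟩
  · exact continuous_const.mul ((continuous_oddHalf hm).comp
      ((continuous_arcsin.comp (continuous_cos.comp (by fun_prop))).div_const _))
  · intro t
    have : (M : ℝ) * (t + 2 * π) + θ (t + 2 * π) = (M * t + θ t) + M * (2 * π) := by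
      rw [hθp t]; ring
    simp only [this, cos_add_nat_mul_two_pi]
  · intro s t
    rw [← mul_sub, abs_mul, abs_of_pos (by positivity : 0 < 1 / lam), one_div,
      inv_mul_le_iff₀ hlam0]
    refine (abs_oddHalf_sub_le h _ _).trans (le_trans ?_ (h.mul_le hlam1 (abs_nonneg _)))
    refine hm.mono (abs_nonneg _) ?_
    rw [← sub_div, abs_div, abs_of_pos hM', div_le_iff₀ hM']
    refine (abs_arcsin_cos_sub_le _ _).trans ?_
    have e1 : (M : ℝ) * s + θ s - (M * t + θ t) = M * (s - t) + (θ s - θ t) := by ring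
    have e2 : lam * |s - t| * M = M * |s - t| + E * |s - t| := by
      rw [hlam]; field_simp
    rw [e1, e2]
    refine (abs_add_le _ _).trans ?_
    rw [abs_mul, abs_of_pos hM']
    linarith [hθlip s t]
  · have hfc := continuous_waveCos hm M
    have hmean : ∫ x in (0 : ℝ)..π, (waveCos ω M x - e / π) = 0 := by
      rw [intervalIntegral.integral_sub (hfc.intervalIntegrable _ _) (by simp),
        integral_waveCos hm, intervalIntegral.integral_const, sub_zero, smul_eq_mul,
        mul_div_cancel₀ _ pi_pos.ne', sub_self]
    have heπ : e / π ≤ ω π := by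
      rw [div_le_iff₀ pi_pos]; nlinarith [pi_gt_three]
    have hbd : ∀ x, |waveCos ω M x - e / π| ≤ 2 * ω π := fun x => by
      refine (abs_sub _ _).trans ?_
      rw [abs_of_nonneg (div_nonneg he0 pi_pos.le)]
      linarith [abs_waveCos_le h hM x]
    have hmain := abs_integral_comp_phase_le (F := fun x => waveCos ω M x - e / π) hM
      (by fun_prop) (fun x => by simp only [periodic_waveCos ω M x]) hbd hmean hr hr'c hθ hθ'c
      hrp hθp hrB hr'B hθ'E
    have hFψ : Continuous fun t => waveCos ω M (M * t + θ t) := hfc.comp (by fun_prop)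
    have hI : ∫ t in (0 : ℝ)..(2 * π), (waveCos ω M (M * t + θ t) - e / π) * r t
        = (∫ t in (0 : ℝ)..(2 * π), waveCos ω M (M * t + θ t) * r t) - e / π * K := by
      have i1 : IntervalIntegrable (fun t => waveCos ω M (M * t + θ t) * r t) volume 0 (2 * π) :=
        (hFψ.mul hrc).intervalIntegrable _ _
      have i2 : IntervalIntegrable (fun t => e / π * r t) volume 0 (2 * π) :=
        (hrc.const_mul _).intervalIntegrable _ _
      rw [hK, ← intervalIntegral.integral_const_mul, ← intervalIntegral.integral_sub i1 i2]
      refine intervalIntegral.integral_congr fun t _ => ?_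
      ring
    have hJ : ∫ t in (0 : ℝ)..(2 * π), 1 / lam * oddHalf ω (arcsin (cos (M * t + θ t)) / M) *
          (r t * cos (M * t + θ t))
        = 1 / lam * ∫ t in (0 : ℝ)..(2 * π), waveCos ω M (M * t + θ t) * r t := by
      rw [← intervalIntegral.integral_const_mul]
      refine intervalIntegral.integral_congr fun t _ => ?_
      simp only [waveCos]
      ring
    rw [hI] at hmain
    rw [hJ]
    set I := ∫ t in (0 : ℝ)..(2 * π), waveCos ω M (M * t + θ t) * r t with hIdef
    set err := 40 * (2 * ω π) * (B' + B * E) / M with herr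
    have herr0 : 0 ≤ err := by positivity
    have h1 := (abs_le.1 hmain).1
    have hinv : 1 - E / M ≤ 1 / lam := by
      rw [le_div_iff₀ hlam0, hlam]
      nlinarith [sq_nonneg (E / M : ℝ)]
    have hinv1 : 1 / lam ≤ 1 := by rw [div_le_one hlam0]; exact hlam1
    have hinv0 : 0 < 1 / lam := by positivity
    have hmK : e / π * K ≤ 2 * ω π * B := by
      calc e / π * K ≤ ω π / π * (B * (2 * π)) := by gcongr
        _ = 2 * ω π * B := by field_simp
    have hmK0 : 0 ≤ e / π * K := by positivity
    have s1 : 1 / lam * (e / π * K - err) ≤ 1 / lam * I :=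
      mul_le_mul_of_nonneg_left (by linarith) hinv0.le
    have s2 : (1 - E / M) * (e / π * K) ≤ 1 / lam * (e / π * K) :=
      mul_le_mul_of_nonneg_right hinv hmK0
    have s3 : 1 / lam * err ≤ err := by nlinarith
    have s4 : E / M * (e / π * K) ≤ E / M * (2 * ω π * B) :=
      mul_le_mul_of_nonneg_left hmK (by positivity)
    have s5 : err + E / M * (2 * ω π * B) ≤ 100 * ω π * (B' + B * E) / M := by
      rw [herr]
      have : 0 ≤ (20 * ω π * B' + 18 * ω π * (B * E)) / M := by positivity
      have e2 : 100 * ω π * (B' + B * E) / M - (40 * (2 * ω π) * (B' + B * E) / M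
        + E / M * (2 * ω π * B)) = (20 * ω π * B' + 18 * ω π * (B * E)) / M := by ring
      linarith
    have e3 : K * (e / π) = e / π * K := mul_comm _ _
    rw [e3]
    linarith

end PoissonVP

/-! ### Oscillatory integrals over H_ω: the upper bound. -/

namespace PoissonVP

variable {ω : ℝ → ℝ}

/-- Recentred at the midpoint, the half wave becomes an odd sine. Folding leaves differences of φ at
symmetric points, whose distance is l·M/π times 2s/M. -/
lemma abs_integral_mul_half_wave_le (h : IsConvexUpwardModulus ω) {M : ℕ} {φ : ℝ → ℝ}
    (hφc : Continuous φ) (hφ : ∀ s t, |φ s - φ t| ≤ ω |s - t|) {a l κ : ℝ} (hM : 0 < M)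
    (hl : 0 < l) (hκ1 : 1 ≤ κ) (hκ : l * M / π ≤ κ) :
    |∫ t in a..(a + l), φ t * cos (π * (t - a) / l)| ≤ l / π * (κ * modulusE M ω) := by
  have hm := h.toIsModulusOfContinuity
  have hM' : (0 : ℝ) < M := by exact_mod_cast hM
  set d := l / π with hd
  have hd0 : 0 < d := div_pos hl pi_pos
  set c := a + l / 2 with hc
  set k : ℝ → ℝ := fun s => φ (d * s + c) * sin s with hk
  have hkc : Continuous k := by fun_prop
  have e1 : ∫ t in a..(a + l), φ t * cos (π * (t - a) / l)
      = d * ∫ s in (-(π / 2))..(π / 2), -k s := by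
    have := intervalIntegral.smul_integral_comp_mul_add (a := -(π / 2)) (b := π / 2)
      (fun t => φ t * cos (π * (t - a) / l)) d c
    rw [show d * -(π / 2) + c = a by rw [hd, hc]; field_simp; ring,
      show d * (π / 2) + c = a + l by rw [hd, hc]; field_simp; ring] at this
    rw [← this, smul_eq_mul]
    congr 1
    refine intervalIntegral.integral_congr fun s _ => ?_
    simp only [hk]
    rw [show π * (d * s + c - a) / l = s + π / 2 by rw [hd, hc]; field_simp; ring,
      cos_add_pi_div_two]
    ring
  have e2 : ∫ s in (-(π / 2))..(π / 2), -k s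
      = -∫ s in (0 : ℝ)..(π / 2), (φ (d * s + c) - φ (d * (-s) + c)) * sin s := by
    have h2 : ∫ x in (-(π / 2))..0, k x = ∫ x in (0 : ℝ)..(π / 2), k (-x) := by
      rw [intervalIntegral.integral_comp_neg, neg_zero]
    rw [intervalIntegral.integral_neg, ← intervalIntegral.integral_add_adjacent_intervals
      (hkc.intervalIntegrable _ 0) (hkc.intervalIntegrable _ _), h2,
      ← intervalIntegral.integral_add ((by fun_prop : Continuous fun s => k (-s)).intervalIntegrable _ _)
        (hkc.intervalIntegrable _ _)]
    congr 1
    refine intervalIntegral.integral_congr fun s _ => ?_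
    simp only [hk, sin_neg]
    ring
  rw [e1, e2, abs_mul, abs_of_pos hd0, abs_neg]
  refine mul_le_mul_of_nonneg_left ?_ hd0.le
  rw [modulusE_eq, ← intervalIntegral.integral_const_mul, ← Real.norm_eq_abs]
  refine intervalIntegral.norm_integral_le_of_norm_le (by positivity) ?_
    (((continuous_modulusE_integrand hm M).const_mul κ).intervalIntegrable _ _)
  refine ae_of_all _ fun s hs => ?_
  have hs0 : 0 ≤ s := hs.1.le
  have hsin : 0 ≤ sin s := sin_nonneg_of_nonneg_of_le_pi hs0 (by linarith [hs.2, pi_pos])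
  rw [norm_mul, Real.norm_eq_abs, Real.norm_eq_abs, abs_of_nonneg hsin, ← mul_assoc]
  refine mul_le_mul_of_nonneg_right ?_ hsin
  have hx : 0 ≤ 2 * s / M := by positivity
  rw [max_eq_left hx]
  refine (hφ _ _).trans (le_trans (hm.mono (abs_nonneg _) ?_) (h.mul_le hκ1 hx))
  rw [show d * s + c - (d * -s + c) = l * M / π * (2 * s / M) by rw [hd]; field_simp; ring,
    abs_of_nonneg (by positivity)]
  exact mul_le_mul_of_nonneg_right hκ hx

/-- Freezing r at a and replacing the phase by its linear interpolant each cost O(b - a) pointwise.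
The half-wave estimate treats what is left, and r(a)(b - a) is then traded back for the integral of
r. -/
lemma abs_integral_between_extrema_le (h : IsConvexUpwardModulus ω) {M : ℕ} (hM : 0 < M)
    {φ r θ : ℝ → ℝ} {W B B' E κ a b : ℝ} (k : ℕ) (hφc : Continuous φ)
    (hφ : ∀ s t, |φ s - φ t| ≤ ω |s - t|) (hφW : ∀ t, |φ t| ≤ W)
    (hrc : Continuous r) (hθc : Continuous θ) (hr0 : ∀ t, 0 ≤ r t) (hrB : ∀ t, |r t| ≤ B)
    (hrlip : ∀ s t, |r s - r t| ≤ B' * |s - t|) (hθlip : ∀ s t, |θ s - θ t| ≤ E * |s - t|)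
    (hB' : 0 ≤ B') (hE : 0 ≤ E)
    (hab : a < b) (ha : M * a + θ a = k * π) (hb : M * b + θ b = (k + 1) * π)
    (hκ1 : 1 ≤ κ) (hκ : (b - a) * M / π ≤ κ) :
    |∫ t in a..b, φ t * (r t * cos (M * t + θ t))| ≤
      W * (B' + 2 * (B * E)) * (b - a) * (b - a)
        + κ * modulusE M ω / π * ((∫ t in a..b, r t) + B' * (b - a) * (b - a)) := by
  have hm := h.toIsModulusOfContinuity
  have hl : 0 < b - a := sub_pos.2 hab
  set l := b - a with hldef
  have hbl : a + l = b := by rw [hldef]; ring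
  have hW0 : 0 ≤ W := (abs_nonneg _).trans (hφW 0)
  have hB0 : 0 ≤ B := (abs_nonneg _).trans (hrB 0)
  set c : ℝ → ℝ := fun t => cos (π * (t - a) / l) with hc
  have hcc : Continuous c := by rw [hc]; fun_prop
  have hsign : ∀ t, cos (π * (t - a) / l + k * π) = (-1) ^ k * c t := fun t =>
    cos_add_nat_mul_pi _ k
  have hσ : |((-1 : ℝ)) ^ k| = 1 := by simp
  have hphase : ∀ t ∈ Ioc a b, |cos (M * t + θ t) - (-1) ^ k * c t| ≤ 2 * E * l := by
    intro t ht
    rw [← hsign]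
    have h1 : |cos (M * t + θ t) - cos (π * (t - a) / l + k * π)|
        ≤ |M * t + θ t - (π * (t - a) / l + k * π)| := by
      have := abs_sub_le_of_hasDerivAt (f := cos) (f' := fun x => -sin x) (C := 1)
        (fun x => hasDerivAt_cos x) (fun x => by rw [abs_neg]; exact abs_sin_le_one x)
        (M * t + θ t) (π * (t - a) / l + k * π)
      simpa using this
    refine h1.trans ?_
    -- The linear part Mt is its own interpolant, so the interpolation error is that of θ alone and
    -- does not grow with M.
    have e1 : M * t + θ t - (π * (t - a) / l + k * π)
        = (θ t - θ a) - (θ b - θ a) * ((t - a) / l) := by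
      have e3 : π = M * l + (θ b - θ a) := by rw [hldef]; linarith
      have e4 : π * (t - a) / l = M * (t - a) + (θ b - θ a) * ((t - a) / l) := by
        rw [e3]; field_simp
      rw [e4, ← ha]; ring
    rw [e1]
    have hta : 0 ≤ t - a := by linarith [ht.1]
    have htl : t - a ≤ l := by rw [hldef]; linarith [ht.2]
    have q1 : |θ t - θ a| ≤ E * l := (hθlip t a).trans (by
      rw [abs_of_nonneg hta]; exact mul_le_mul_of_nonneg_left htl hE)
    have q2 : |θ b - θ a| ≤ E * l := by
      have := hθlip b a; rwa [← hldef, abs_of_pos hl] at this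
    have q3 : |(t - a) / l| ≤ 1 := by
      rw [abs_of_nonneg (by positivity), div_le_one hl]; exact htl
    refine (abs_sub _ _).trans ?_
    rw [abs_mul]
    have : |θ b - θ a| * |(t - a) / l| ≤ E * l * 1 :=
      mul_le_mul q2 q3 (abs_nonneg _) (by positivity)
    linarith
  have hψc : Continuous fun t => cos (M * t + θ t) := by fun_prop
  have hsplit : ∫ t in a..b, φ t * (r t * cos (M * t + θ t))
      = (∫ t in a..b, φ t * (r t * cos (M * t + θ t) - r a * ((-1) ^ k * c t)))
        + r a * (-1) ^ k * ∫ t in a..b, φ t * c t := by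
    rw [← intervalIntegral.integral_const_mul, ← intervalIntegral.integral_add]
    · refine intervalIntegral.integral_congr fun t _ => ?_
      ring
    · exact (by fun_prop : Continuous fun t =>
        φ t * (r t * cos (M * t + θ t) - r a * ((-1) ^ k * c t))).intervalIntegrable _ _
    · exact (by fun_prop : Continuous fun t => r a * (-1) ^ k * (φ t * c t)).intervalIntegrable _ _
  have b1 : |∫ t in a..b, φ t * (r t * cos (M * t + θ t) - r a * ((-1) ^ k * c t))|
      ≤ W * (B' + 2 * (B * E)) * l * l := by
    have := intervalIntegral.norm_integral_le_of_norm_le_const (a := a) (b := b)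
      (f := fun t => φ t * (r t * cos (M * t + θ t) - r a * ((-1) ^ k * c t)))
      (C := W * (B' + 2 * (B * E)) * l) fun t ht => ?_
    · rwa [← hldef, abs_of_pos hl] at this
    rw [uIoc_of_le hab.le] at ht
    have hta : 0 ≤ t - a := by linarith [ht.1]
    have htl : t - a ≤ l := by rw [hldef]; linarith [ht.2]
    rw [Real.norm_eq_abs, abs_mul, mul_assoc]
    refine mul_le_mul (hφW t) ?_ (abs_nonneg _) hW0
    rw [show r t * cos (M * t + θ t) - r a * ((-1) ^ k * c t)
      = (r t - r a) * cos (M * t + θ t) + r a * (cos (M * t + θ t) - (-1) ^ k * c t) by ring]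
    refine (abs_add_le _ _).trans ?_
    rw [abs_mul, abs_mul]
    have p1 : |r t - r a| * |cos (M * t + θ t)| ≤ B' * l * 1 :=
      mul_le_mul ((hrlip t a).trans (by
        rw [abs_of_nonneg hta]; exact mul_le_mul_of_nonneg_left htl hB'))
        (abs_cos_le_one _) (abs_nonneg _) (by positivity)
    have p2 := mul_le_mul (hrB a) (hphase t ht) (abs_nonneg _) hB0
    linarith
  have b2 : |∫ t in a..b, φ t * c t| ≤ l / π * (κ * modulusE M ω) := by
    have := abs_integral_mul_half_wave_le h hφc hφ (a := a) hM hl hκ1 hκ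
    rwa [hbl] at this
  have b3 : r a * l ≤ (∫ t in a..b, r t) + B' * l * l := by
    have h1 : ∫ t in a..b, (r a - B' * l) = (r a - B' * l) * l := by
      rw [intervalIntegral.integral_const, smul_eq_mul, mul_comm]
    have h2 : ∫ t in a..b, (r a - B' * l) ≤ ∫ t in a..b, r t := by
      refine intervalIntegral.integral_mono_on hab.le (by simp) (hrc.intervalIntegrable _ _)
        fun t ht => ?_
      have := (abs_le.1 (hrlip t a)).1
      rw [abs_of_nonneg (by linarith [ht.1] : 0 ≤ t - a)] at this
      have h3 : B' * (t - a) ≤ B' * l :=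
        mul_le_mul_of_nonneg_left (by rw [hldef]; linarith [ht.2]) hB'
      linarith
    rw [h1] at h2
    linarith
  rw [hsplit]
  refine (abs_add_le _ _).trans (add_le_add b1 ?_)
  rw [abs_mul, abs_mul, hσ, mul_one, abs_of_nonneg (hr0 a)]
  have he0 := modulusE_nonneg hm M
  calc r a * |∫ t in a..b, φ t * c t| ≤ r a * (l / π * (κ * modulusE M ω)) :=
        mul_le_mul_of_nonneg_left b2 (hr0 a)
    _ = κ * modulusE M ω / π * (r a * l) := by ring
    _ ≤ _ := mul_le_mul_of_nonneg_left b3 (by positivity)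

/-- By periodicity t may be moved to within π of 0. -/
lemma abs_sub_le_of_mem_classH (h : IsModulusOfContinuity ω) {φ : ℝ → ℝ} (hφ : φ ∈ classH ω)
    (t : ℝ) : |φ t - φ 0| ≤ ω π := by
  obtain ⟨-, hper, hmod⟩ := hφ
  have hp : (0 : ℝ) < 2 * π := by positivity
  have h1 := abs_sub_round (t / (2 * π))
  have h2 : t - round (t / (2 * π)) * (2 * π) = (t / (2 * π) - round (t / (2 * π))) * (2 * π) := by
    field_simp
  rw [← hper.sub_int_mul_eq (round (t / (2 * π))) (x := t)]
  refine (hmod _ _).trans (h.mono (abs_nonneg _) ?_)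
  rw [sub_zero, h2, abs_mul, abs_of_pos hp]
  nlinarith

/-- The kernel annihilates constants, so φ can be replaced by φ - φ(0), which is bounded by ω(π).
The half-wave bound is then summed over the 2M arcs of one period. -/
lemma abs_integral_le_of_mem_classH (h : IsConvexUpwardModulus ω) {φ r r' θ θ' : ℝ → ℝ}
    {B B' E : ℝ} {M : ℕ} (hφ : φ ∈ classH ω) (hM : 0 < M)
    (hr : ∀ t, HasDerivAt r (r' t) t) (hθ : ∀ t, HasDerivAt θ (θ' t) t)
    (hrp : Function.Periodic r (2 * π)) (hθp : Function.Periodic θ (2 * π))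
    (hr0 : ∀ t, 0 ≤ r t)
    (hrB : ∀ t, |r t| ≤ B) (hr'B : ∀ t, |r' t| ≤ B') (hθ'E : ∀ t, |θ' t| ≤ E)
    (hzero : ∫ t in (0 : ℝ)..(2 * π), r t * cos (M * t + θ t) = 0) :
    |∫ t in (0 : ℝ)..(2 * π), φ t * (r t * cos (M * t + θ t))| ≤
      (∫ t in (0 : ℝ)..(2 * π), r t) * (modulusE M ω / π) + 100 * ω π * (B' + B * E) / M := by
  have hm := h.toIsModulusOfContinuity
  have hM' : (0 : ℝ) < M := by exact_mod_cast hM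
  have hB0 : 0 ≤ B := (abs_nonneg _).trans (hrB 0)
  have hB0' : 0 ≤ B' := (abs_nonneg _).trans (hr'B 0)
  have hE0 : 0 ≤ E := (abs_nonneg _).trans (hθ'E 0)
  have hrc : Continuous r := continuous_iff_continuousAt.2 fun t => (hr t).continuousAt
  have hθc : Continuous θ := continuous_iff_continuousAt.2 fun t => (hθ t).continuousAt
  have hω0 : 0 ≤ ω π := hm.nonneg pi_pos.le
  have hrlip := abs_sub_le_of_hasDerivAt hr hr'B
  have hθlip := abs_sub_le_of_hasDerivAt hθ hθ'E
  set e := modulusE M ω with he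
  have he0 : 0 ≤ e := modulusE_nonneg hm M
  have heω : e ≤ ω π := modulusE_le hm hM
  set K := ∫ t in (0 : ℝ)..(2 * π), r t with hK
  have hK0 : 0 ≤ K := intervalIntegral.integral_nonneg (by positivity) fun t _ => hr0 t
  have hKB : K ≤ B * (2 * π) := (le_abs_self _).trans (abs_integral_le_of_abs_le hrB)
  set χ : ℝ → ℝ := fun t => φ t - φ 0 with hχ
  have hφc := hφ.1
  have hχc : Continuous χ := by rw [hχ]; fun_prop
  have hχp : Function.Periodic χ (2 * π) := fun t => by simp only [hχ, hφ.2.1 t]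
  have hχω : ∀ s t, |χ s - χ t| ≤ ω |s - t| := fun s t => by
    simpa [hχ] using hφ.2.2 s t
  have hχW : ∀ t, |χ t| ≤ ω π := abs_sub_le_of_mem_classH hm hφ
  set f : ℝ → ℝ := fun t => χ t * (r t * cos (M * t + θ t)) with hf
  have hfc : Continuous f := by rw [hf]; fun_prop
  have hred : ∫ t in (0 : ℝ)..(2 * π), φ t * (r t * cos (M * t + θ t))
      = ∫ t in (0 : ℝ)..(2 * π), f t := by
    have h1 : ∫ t in (0 : ℝ)..(2 * π), f t = (∫ t in (0 : ℝ)..(2 * π),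
        φ t * (r t * cos (M * t + θ t)))
        - ∫ t in (0 : ℝ)..(2 * π), φ 0 * (r t * cos (M * t + θ t)) := by
      have i1 : IntervalIntegrable (fun t => φ t * (r t * cos (M * t + θ t))) volume 0 (2 * π) :=
        (by fun_prop : Continuous _).intervalIntegrable _ _
      have i2 : IntervalIntegrable (fun t => φ 0 * (r t * cos (M * t + θ t))) volume 0 (2 * π) :=
        (by fun_prop : Continuous _).intervalIntegrable _ _
      rw [← intervalIntegral.integral_sub i1 i2]
      refine intervalIntegral.integral_congr fun t _ => ?_
      simp only [hf, hχ]
      ring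
    rw [h1, intervalIntegral.integral_const_mul, hzero, mul_zero, sub_zero]
  rw [hred]
  -- When E > M/2 the phase need not be monotone, but BE/M > B/2 (if B > 0), so the remainder
  -- already covers the trivial bound 2πBω(π).
  rcases lt_or_ge (M / 2 : ℝ) E with hEM | hEM
  · have h1 : |∫ t in (0 : ℝ)..(2 * π), f t| ≤ ω π * B * (2 * π) :=
      abs_integral_le_of_abs_le fun t => by
        simp only [hf]
        rw [abs_mul, abs_mul]
        have : |r t| * |cos (M * t + θ t)| ≤ B * 1 :=
          mul_le_mul (hrB t) (abs_cos_le_one _) (abs_nonneg _) hB0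
        rw [mul_one] at this
        exact mul_le_mul (hχW t) this (by positivity) hω0
    refine h1.trans ?_
    have h2 : 0 ≤ K * (e / π) := by positivity
    have h3 : ω π * B * (2 * π) ≤ 100 * ω π * (B' + B * E) / M := by
      rw [le_div_iff₀ hM']
      have p1 : 0 ≤ ω π * B := by positivity
      have p2 : 2 * π * M ≤ 100 * E := by
        nlinarith [pi_lt_four, pi_pos]
      have p3 : 0 ≤ 100 * ω π * B' := by positivity
      nlinarith [mul_le_mul_of_nonneg_left p2 p1]
    linarith
  set ψ : ℝ → ℝ := fun t => M * t + θ t with hψ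
  have hψc : Continuous ψ := by rw [hψ]; fun_prop
  have hME : 0 < M - E := by linarith
  have hψge : ∀ s t, s ≤ t → (M - E) * (t - s) ≤ ψ t - ψ s := fun s t hst => by
    have := (abs_le.1 (hθlip t s)).1
    rw [abs_of_nonneg (sub_nonneg.2 hst)] at this
    simp only [hψ]
    linarith
  have hmono : StrictMono ψ := fun s t hst => by
    have := hψge s t hst.le
    have := mul_pos hME (sub_pos.2 hst)
    linarith
  have hsurj : Function.Surjective ψ := by
    refine hψc.surjective ?_ ?_
    · refine tendsto_atTop_mono' atTop (f₁ := fun t => (M - E) * t + ψ 0) ?_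
        (tendsto_atTop_add_const_right _ _ (tendsto_id.const_mul_atTop hME))
      filter_upwards [eventually_ge_atTop 0] with t ht
      have := hψge 0 t ht
      rw [sub_zero] at this
      linarith
    · refine tendsto_atBot_mono' atBot (f₁ := fun t => (M - E) * t + ψ 0) ?_
        (tendsto_atBot_add_const_right _ _ (tendsto_id.const_mul_atBot hME))
      filter_upwards [eventually_le_atBot 0] with t ht
      have := hψge t 0 ht
      rw [zero_sub] at this
      linarith
  -- The cut points are the extrema of the cosine. Over a period the phase gains 2πM, so 2M
  -- consecutive arcs make exactly one period.
  choose a ha using fun k : ℕ => hsurj (k * π)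
  have halt : ∀ k, a k < a (k + 1) := fun k => by
    rw [← hmono.lt_iff_lt, ha, ha]
    push_cast
    linarith [pi_pos]
  have hend : a (2 * M) = a 0 + 2 * π := by
    apply hmono.injective
    have h1 : ψ (a 0 + 2 * π) = ψ (a 0) + 2 * M * π := by
      simp only [hψ, hθp (a 0)]; ring
    rw [h1, ha, ha]
    push_cast
    ring
  have hlen : ∀ k, a (k + 1) - a k ≤ 2 * π / M := fun k => by
    have h1 := hψge _ _ (halt k).le
    rw [ha, ha] at h1
    push_cast at h1
    rw [le_div_iff₀ hM']
    nlinarith [halt k]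
  -- On an arc of length l the phase gains π, so lM ≤ π + El; with l ≤ 2π/M this gives lM/π ≤ 1 +
  -- 2E/M.
  set κ : ℝ := 1 + 2 * E / M with hκ
  have hκ1 : 1 ≤ κ := by rw [hκ]; linarith [div_nonneg (mul_nonneg zero_le_two hE0) hM'.le]
  have hκ2 : κ ≤ 2 := by
    have : 2 * E / M ≤ 1 := by rw [div_le_one hM']; linarith
    rw [hκ]; linarith
  have hκl : ∀ k, (a (k + 1) - a k) * M / π ≤ κ := fun k => by
    have h1 := hψge _ _ (halt k).le
    rw [ha, ha] at h1
    push_cast at h1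
    have h2 := mul_le_mul_of_nonneg_left (hlen k) hE0
    rw [div_le_iff₀ pi_pos, hκ]
    have h3 : (1 + 2 * E / M) * π = π + E * (2 * π / M) := by ring
    rw [h3]
    linarith
  have hper : Function.Periodic f (2 * π) := fun t => by
    simp only [hf, hχp t, hrp t, hθp t]
    rw [show (M : ℝ) * (t + 2 * π) + θ t = (M * t + θ t) + M * (2 * π) by ring,
      cos_add_nat_mul_two_pi]
  have hint : ∀ g : ℝ → ℝ, Continuous g → Function.Periodic g (2 * π) →
      ∫ t in (0 : ℝ)..(2 * π), g t
        = ∑ k ∈ Finset.range (2 * M), ∫ t in (a k)..(a (k + 1)), g t := by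
    intro g hg hgp
    rw [intervalIntegral.sum_integral_adjacent_intervals fun k _ => hg.intervalIntegrable _ _,
      hend, hgp.intervalIntegral_add_eq (a 0) 0, zero_add]
  have hpiece : ∀ k, |∫ t in (a k)..(a (k + 1)), f t| ≤
      ω π * (B' + 2 * (B * E)) * (2 * π / M) * (a (k + 1) - a k)
        + κ * e / π * ((∫ t in (a k)..(a (k + 1)), r t)
          + B' * (2 * π / M) * (a (k + 1) - a k)) := by
    intro k
    have hl : 0 ≤ a (k + 1) - a k := sub_nonneg.2 (halt k).le
    have h1 := abs_integral_between_extrema_le h hM k hχc hχω hχW hrc hθc hr0 hrB hrlip hθlip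
      hB0' hE0 (halt k) (ha k) (by simpa using ha (k + 1)) hκ1 (hκl k)
    refine h1.trans ?_
    have hl2 := hlen k
    rw [← he]
    gcongr
  have hsum : ∑ k ∈ Finset.range (2 * M), (a (k + 1) - a k) = 2 * π := by
    rw [Finset.sum_range_sub, hend]; ring
  have htot : |∫ t in (0 : ℝ)..(2 * π), f t| ≤
      ω π * (B' + 2 * (B * E)) * (2 * π / M) * (2 * π)
        + κ * e / π * (K + B' * (2 * π / M) * (2 * π)) := by
    rw [hint f hfc hper]
    refine (Finset.abs_sum_le_sum_abs _ _).trans ((Finset.sum_le_sum fun k _ => hpiece k).trans ?_)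
    rw [Finset.sum_add_distrib, ← Finset.mul_sum, ← Finset.mul_sum, Finset.sum_add_distrib,
      ← Finset.mul_sum, hsum, ← hint r hrc hrp]
  refine htot.trans ?_
  have c1 : κ * e / π * (K + B' * (2 * π / M) * (2 * π))
      = K * (e / π) + (2 * E / M) * (e * (K / π)) + κ * e * (4 * π * B' / M) := by
    rw [hκ]; field_simp; ring
  have c2 : e * (K / π) ≤ ω π * (2 * B) := by
    refine mul_le_mul heω ?_ (by positivity) hω0
    rw [div_le_iff₀ pi_pos]; linarith
  have c3 : (2 * E / M) * (e * (K / π)) ≤ (2 * E / M) * (ω π * (2 * B)) :=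
    mul_le_mul_of_nonneg_left c2 (by positivity)
  have c4 : κ * e * (4 * π * B' / M) ≤ 2 * ω π * (4 * π * B' / M) := by gcongr
  have hp1 : π * π ≤ 10 := by nlinarith [pi_lt_d2, pi_pos]
  have hp2 : π ≤ 4 := pi_lt_four.le
  have c5 : ω π * (B' + 2 * (B * E)) * (2 * π / M) * (2 * π) + (2 * E / M) * (ω π * (2 * B))
      + 2 * ω π * (4 * π * B' / M) ≤ 100 * ω π * (B' + B * E) / M := by
    have q1 : ω π * (B' + 2 * (B * E)) * (2 * π / M) * (2 * π) + (2 * E / M) * (ω π * (2 * B))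
      + 2 * ω π * (4 * π * B' / M) = (ω π * B' * (4 * (π * π) + 8 * π)
        + ω π * (B * E) * (8 * (π * π) + 4)) / M := by ring
    rw [q1]
    refine div_le_div_of_nonneg_right ?_ hM'.le
    have p1 : 0 ≤ ω π * B' := by positivity
    have p2 : 0 ≤ ω π * (B * E) := by positivity
    nlinarith [mul_le_mul_of_nonneg_left (by linarith : 4 * (π * π) + 8 * π ≤ 100) p1,
      mul_le_mul_of_nonneg_left (by linarith : 8 * (π * π) + 4 ≤ 100) p2]
  rw [c1]
  linarith

end PoissonVP

/-! ### Amplitude and phase of the kernel. -/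

namespace PoissonVP

/-- `1 - ρ e^{i k t}`. -/
noncomputable def oneSubExp (ρ : ℝ) (k : ℕ) (t : ℝ) : ℂ :=
  1 - ρ * Complex.exp ((k * t : ℝ) * Complex.I)

lemma oneSubExp_re (ρ : ℝ) (k : ℕ) (t : ℝ) : (oneSubExp ρ k t).re = 1 - ρ * cos (k * t) := by
  unfold oneSubExp
  rw [Complex.sub_re, Complex.re_ofReal_mul, Complex.exp_ofReal_mul_I_re, Complex.one_re]

lemma oneSubExp_im (ρ : ℝ) (k : ℕ) (t : ℝ) : (oneSubExp ρ k t).im = -(ρ * sin (k * t)) := by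
  unfold oneSubExp
  rw [Complex.sub_im, Complex.im_ofReal_mul, Complex.exp_ofReal_mul_I_im, Complex.one_im, zero_sub]

/-- The values stay in the right half-plane, so the principal logarithm is smooth along the curve
and the phase is 2π-periodic, without winding. -/
lemma oneSubExp_re_pos {ρ : ℝ} (h0 : 0 ≤ ρ) (h1 : ρ < 1) (k : ℕ) (t : ℝ) :
    0 < (oneSubExp ρ k t).re := by
  rw [oneSubExp_re]
  nlinarith [cos_le_one (k * t)]

lemma oneSubExp_ne_zero {ρ : ℝ} (h0 : 0 ≤ ρ) (h1 : ρ < 1) (k : ℕ) (t : ℝ) :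
    oneSubExp ρ k t ≠ 0 := fun h => by
  have := oneSubExp_re_pos h0 h1 k t
  rw [h] at this
  exact lt_irrefl _ this

lemma norm_oneSubExp_sq (ρ : ℝ) (k : ℕ) (t : ℝ) :
    ‖oneSubExp ρ k t‖ ^ 2 = 1 - 2 * ρ * cos (k * t) + ρ ^ 2 := by
  rw [Complex.sq_norm, Complex.normSq_apply, oneSubExp_re, oneSubExp_im]
  have := sin_sq_add_cos_sq (k * t)
  linear_combination ρ ^ 2 * this

lemma one_sub_le_norm_oneSubExp {ρ : ℝ} (h0 : 0 ≤ ρ) (k : ℕ) (t : ℝ) :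
    1 - ρ ≤ ‖oneSubExp ρ k t‖ := by
  refine le_trans ?_ (Complex.re_le_norm _)
  rw [oneSubExp_re]
  nlinarith [cos_le_one (k * t)]

lemma norm_oneSubExp_le {ρ : ℝ} (h0 : 0 ≤ ρ) (k : ℕ) (t : ℝ) : ‖oneSubExp ρ k t‖ ≤ 1 + ρ := by
  unfold oneSubExp
  refine (norm_sub_le _ _).trans ?_
  rw [norm_one, norm_mul, Complex.norm_exp_ofReal_mul_I, Complex.norm_real, Real.norm_eq_abs,
    abs_of_nonneg h0, mul_one]

lemma periodic_oneSubExp (ρ : ℝ) (k : ℕ) : Function.Periodic (oneSubExp ρ k) (2 * π) := by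
  intro t
  apply Complex.ext
  · rw [oneSubExp_re, oneSubExp_re, mul_add, cos_add_nat_mul_two_pi]
  · rw [oneSubExp_im, oneSubExp_im, mul_add, sin_add_nat_mul_two_pi]

lemma continuous_oneSubExp (ρ : ℝ) (k : ℕ) : Continuous (oneSubExp ρ k) := by
  unfold oneSubExp; fun_prop

/-- The logarithmic derivative of `oneSubExp ρ k`. -/
noncomputable def logDerivOneSubExp (ρ : ℝ) (k : ℕ) (t : ℝ) : ℂ :=
  -(ρ * (Complex.exp ((k * t : ℝ) * Complex.I) * (k * Complex.I))) / oneSubExp ρ k t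

lemma hasDerivAt_log_oneSubExp {ρ : ℝ} (h0 : 0 ≤ ρ) (h1 : ρ < 1) (k : ℕ) (t : ℝ) :
    HasDerivAt (fun t => Complex.log (oneSubExp ρ k t)) (logDerivOneSubExp ρ k t) t := by
  refine HasDerivAt.clog_real ?_ (Or.inl (oneSubExp_re_pos h0 h1 k t))
  unfold oneSubExp
  have e1 : HasDerivAt (fun t : ℝ => ((k * t : ℝ) : ℂ) * Complex.I) (k * Complex.I) t := by
    have := ((hasDerivAt_id t).const_mul (k : ℝ)).ofReal_comp.mul_const Complex.I
    simpa using this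
  exact ((e1.cexp.const_mul (ρ : ℂ)).const_sub 1)

lemma continuous_logDerivOneSubExp {ρ : ℝ} (h0 : 0 ≤ ρ) (h1 : ρ < 1) (k : ℕ) :
    Continuous (logDerivOneSubExp ρ k) := by
  unfold logDerivOneSubExp
  exact Continuous.div (by fun_prop) (continuous_oneSubExp ρ k) (oneSubExp_ne_zero h0 h1 k)

lemma norm_logDerivOneSubExp_le {ρ : ℝ} (h0 : 0 ≤ ρ) (h1 : ρ < 1) (k : ℕ) (t : ℝ) :
    ‖logDerivOneSubExp ρ k t‖ ≤ k * ρ / (1 - ρ) := by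
  unfold logDerivOneSubExp
  rw [norm_div, norm_neg, norm_mul, norm_mul, Complex.norm_exp_ofReal_mul_I, norm_mul,
    Complex.norm_I, Complex.norm_natCast, Complex.norm_real, Real.norm_eq_abs, abs_of_nonneg h0]
  have := one_sub_le_norm_oneSubExp h0 k t
  have h2 : 0 < 1 - ρ := by linarith
  rw [one_mul, mul_one, mul_comm ρ]
  exact div_le_div_of_nonneg_left (by positivity) h2 this

/-- Each of the p terms of the geometric sum (1 - q^p)/(1 - q) is at least q^p. This makes the
logarithmic derivative of 1 - z^p bounded uniformly in p. -/
lemma natCast_mul_pow_div_le {q : ℝ} (h0 : 0 < q) (h1 : q < 1) {p : ℕ} (hp : 0 < p) :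
    p * q ^ p / (1 - q ^ p) ≤ 1 / (1 - q) := by
  have h2 : 0 < 1 - q := by linarith
  have h3 : 0 < 1 - q ^ p := by
    have := pow_lt_one₀ h0.le h1 hp.ne'
    linarith
  rw [div_le_div_iff₀ h3 h2, one_mul, ← mul_neg_geom_sum q p]
  have : (p : ℝ) * q ^ p ≤ ∑ i ∈ Finset.range p, q ^ i := by
    rw [← nsmul_eq_mul, ← Finset.card_range p, ← Finset.sum_const, Finset.card_range]
    exact Finset.sum_le_sum fun i hi =>
      pow_le_pow_of_le_one h0.le h1.le (Finset.mem_range.1 hi).le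
  rw [mul_comm]
  exact mul_le_mul_of_nonneg_left this h2.le

/-- A logarithm of `e^{iγ} (1 - z^p) / (1 - z)²`, `z = q e^{it}`. -/
noncomputable def kernelLog (q γ : ℝ) (p : ℕ) (t : ℝ) : ℂ :=
  Complex.log (oneSubExp (q ^ p) p t) - 2 * Complex.log (oneSubExp q 1 t) + γ * Complex.I

/-- The derivative of `kernelLog`. -/
noncomputable def kernelLogDeriv (q : ℝ) (p : ℕ) (t : ℝ) : ℂ :=
  logDerivOneSubExp (q ^ p) p t - 2 * logDerivOneSubExp q 1 t

/-- The modulus `|1 - z^p| / |1 - z|²`. -/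
noncomputable def kernelAmp (q γ : ℝ) (p : ℕ) (t : ℝ) : ℝ := exp (kernelLog q γ p t).re

lemma periodic_kernelLog (q γ : ℝ) (p : ℕ) : Function.Periodic (kernelLog q γ p) (2 * π) := fun t => by
  unfold kernelLog
  rw [periodic_oneSubExp _ _ t, periodic_oneSubExp _ _ t]

section

variable {q : ℝ} (h0 : 0 < q) (h1 : q < 1) (γ : ℝ) {p : ℕ} (hp : 0 < p)
include h0 h1 hp

lemma hasDerivAt_kernelLog (t : ℝ) :
    HasDerivAt (kernelLog q γ p) (kernelLogDeriv q p t) t :=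
  ((hasDerivAt_log_oneSubExp (by positivity) (pow_lt_one₀ h0.le h1 hp.ne') p t).sub
    ((hasDerivAt_log_oneSubExp h0.le h1 1 t).const_mul 2)).add_const _

lemma continuous_kernelLogDeriv : Continuous (kernelLogDeriv q p) :=
  (continuous_logDerivOneSubExp (by positivity) (pow_lt_one₀ h0.le h1 hp.ne') p).sub
    (continuous_const.mul (continuous_logDerivOneSubExp h0.le h1 1))

lemma norm_kernelLogDeriv_le (t : ℝ) : ‖kernelLogDeriv q p t‖ ≤ 3 / (1 - q) := by
  have a1 := norm_logDerivOneSubExp_le (by positivity) (pow_lt_one₀ h0.le h1 hp.ne') p t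
  have a2 := norm_logDerivOneSubExp_le h0.le h1 1 t
  have a3 := natCast_mul_pow_div_le h0 h1 hp
  have a4 : ((1 : ℕ) : ℝ) * q / (1 - q) ≤ 1 / (1 - q) :=
    div_le_div_of_nonneg_right (by rw [Nat.cast_one, one_mul]; exact h1.le) (by linarith)
  unfold kernelLogDeriv
  refine (norm_sub_le _ _).trans ?_
  rw [norm_mul, Complex.norm_ofNat, show (3 : ℝ) / (1 - q) = 1 / (1 - q) + 2 * (1 / (1 - q)) by ring]
  linarith

lemma hasDerivAt_kernelLog_im (t : ℝ) :
    HasDerivAt (fun t => (kernelLog q γ p t).im) (kernelLogDeriv q p t).im t :=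
  Complex.imCLM.hasFDerivAt.comp_hasDerivAt t (hasDerivAt_kernelLog h0 h1 γ hp t)

lemma hasDerivAt_kernelAmp (t : ℝ) :
    HasDerivAt (kernelAmp q γ p) (kernelAmp q γ p t * (kernelLogDeriv q p t).re) t :=
  HasDerivAt.exp (Complex.reCLM.hasFDerivAt.comp_hasDerivAt t (hasDerivAt_kernelLog h0 h1 γ hp t))

lemma exp_kernelLog (t : ℝ) : Complex.exp (kernelLog q γ p t)
    = oneSubExp (q ^ p) p t / oneSubExp q 1 t ^ 2 * Complex.exp (γ * Complex.I) := by
  unfold kernelLog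
  rw [Complex.exp_add, Complex.exp_sub, two_mul, Complex.exp_add,
    Complex.exp_log (oneSubExp_ne_zero (by positivity) (pow_lt_one₀ h0.le h1 hp.ne') p t),
    Complex.exp_log (oneSubExp_ne_zero h0.le h1 1 t), sq]

lemma kernelAmp_eq_norm (t : ℝ) :
    kernelAmp q γ p t = ‖oneSubExp (q ^ p) p t‖ / ‖oneSubExp q 1 t‖ ^ 2 := by
  unfold kernelAmp
  rw [← Complex.norm_exp, exp_kernelLog h0 h1 γ hp, norm_mul, Complex.norm_exp_ofReal_mul_I,
    mul_one, norm_div, norm_pow]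

lemma integral_kernelAmp : ∫ t in (0 : ℝ)..(2 * π), kernelAmp q γ p t = constK p q := by
  unfold constK
  refine intervalIntegral.integral_congr fun t _ => ?_
  rw [kernelAmp_eq_norm h0 h1 γ hp, norm_oneSubExp_sq, Nat.cast_one, one_mul]
  congr 1
  rw [← Real.sqrt_sq (norm_nonneg (oneSubExp (q ^ p) p t)), norm_oneSubExp_sq]
  congr 1
  ring

/-- For p = 1 the numerator cancels one factor of the denominator, which is why δ(1) is smaller. The
remaining power of 1/(1 - q) in the error comes from the logarithmic derivative. -/
lemma kernelAmp_le (t : ℝ) : kernelAmp q γ p t ≤ 2 / (1 - q) ^ (expDelta p - 1) := by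
  rw [kernelAmp_eq_norm h0 h1 γ hp]
  have hD : 0 < 1 - q := by linarith
  have b1 := one_sub_le_norm_oneSubExp h0.le 1 t
  have b2 : 0 < ‖oneSubExp q 1 t‖ := by linarith
  by_cases h : p = 1
  · subst h
    simp only [expDelta, if_true, pow_one]
    rw [show 2 - 1 = 1 from rfl, pow_one, sq, div_mul_cancel_left₀ b2.ne', ← one_div,
      div_le_div_iff₀ b2 hD]
    linarith
  · simp only [expDelta, if_neg h]
    have b3 := norm_oneSubExp_le (pow_nonneg h0.le p) p t
    have b4 : q ^ p ≤ 1 := pow_le_one₀ h0.le h1.le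
    exact div_le_div₀ (by norm_num) (by linarith) (by positivity)
      (pow_le_pow_left₀ hD.le b1 2)

/-- A lower bound free of p, from q^p ≤ q and |1 - z| ≤ 2; it allows p to vary in the asymptotic
statement. -/
lemma one_sub_div_four_le_kernelAmp (t : ℝ) : (1 - q) / 4 ≤ kernelAmp q γ p t := by
  rw [kernelAmp_eq_norm h0 h1 γ hp]
  have hD : 0 < 1 - q := by linarith
  have b1 := one_sub_le_norm_oneSubExp h0.le 1 t
  have b2 : 0 < ‖oneSubExp q 1 t‖ := by linarith
  have b3 := one_sub_le_norm_oneSubExp (pow_nonneg h0.le p) p t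
  have b4 : q ^ p ≤ q := pow_le_of_le_one h0.le h1.le hp.ne'
  have b5 := norm_oneSubExp_le h0.le 1 t
  refine div_le_div₀ (norm_nonneg _) (by linarith) (by positivity) ?_
  nlinarith

end

end PoissonVP

namespace PoissonVP

/-! ### Fourier sums of absolutely convergent trigonometric series. -/

section FourierCoefficients

lemma integral_cos_int_mul (n : ℤ) :
    ∫ t in (-π)..π, cos (n * t) = if n = 0 then 2 * π else 0 := by
  split_ifs with h
  · subst h
    simp
    ring
  · have hn : (n : ℝ) ≠ 0 := by exact_mod_cast h
    rw [intervalIntegral.integral_comp_mul_left _ hn, integral_cos, mul_neg, sin_neg,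
      sin_int_mul_pi]
    simp

lemma integral_sin_int_mul (n : ℤ) : ∫ t in (-π)..π, sin (n * t) = 0 := by
  rcases eq_or_ne n 0 with h | h
  · subst h; simp
  · have hn : (n : ℝ) ≠ 0 := by exact_mod_cast h
    rw [intervalIntegral.integral_comp_mul_left _ hn, integral_sin, mul_neg, cos_neg]
    simp

lemma integral_harmonic_mul_cos (a b : ℝ) (k j : ℕ) :
    ∫ t in (-π)..π, (a * cos (k * t) + b * sin (k * t)) * cos (j * t)
      = if k = j then (if j = 0 then 2 * π * a else π * a) else 0 := by
  have e : ∀ t : ℝ, (a * cos (k * t) + b * sin (k * t)) * cos (j * t)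
      = a / 2 * cos (((k - j : ℤ) : ℝ) * t) + a / 2 * cos (((k + j : ℤ) : ℝ) * t)
        + (b / 2 * sin (((k - j : ℤ) : ℝ) * t) + b / 2 * sin (((k + j : ℤ) : ℝ) * t)) := by
    intro t
    push_cast
    rw [sub_mul, add_mul (k : ℝ) j t, cos_sub, cos_add, sin_sub, sin_add]
    ring
  simp_rw [e]
  rw [intervalIntegral.integral_add, intervalIntegral.integral_add, intervalIntegral.integral_add]
  · simp only [intervalIntegral.integral_const_mul, integral_sin_int_mul, integral_cos_int_mul]
    by_cases h : k = j
    · subst h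
      by_cases h0 : k = 0
      · subst h0; simp; ring
      · have : (k : ℤ) + k ≠ 0 := by omega
        simp [h0, this]; ring
    · have h1 : (k : ℤ) - j ≠ 0 := by omega
      have h2 : (k : ℤ) + j ≠ 0 := by omega
      simp only [if_neg h, if_neg h1, if_neg h2]; ring
  all_goals exact Continuous.intervalIntegrable (by fun_prop) _ _

lemma integral_harmonic_mul_sin (a b : ℝ) (k : ℕ) {j : ℕ} (hj : j ≠ 0) :
    ∫ t in (-π)..π, (a * cos (k * t) + b * sin (k * t)) * sin (j * t)
      = if k = j then π * b else 0 := by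
  have e : ∀ t : ℝ, (a * cos (k * t) + b * sin (k * t)) * sin (j * t)
      = b / 2 * cos (((k - j : ℤ) : ℝ) * t) + -(b / 2) * cos (((k + j : ℤ) : ℝ) * t)
        + (-(a / 2) * sin (((k - j : ℤ) : ℝ) * t) + a / 2 * sin (((k + j : ℤ) : ℝ) * t)) := by
    intro t
    push_cast
    rw [sub_mul, add_mul (k : ℝ) j t, cos_sub, cos_add, sin_sub, sin_add]
    ring
  simp_rw [e]
  rw [intervalIntegral.integral_add, intervalIntegral.integral_add, intervalIntegral.integral_add]
  · simp only [intervalIntegral.integral_const_mul, integral_sin_int_mul, integral_cos_int_mul]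
    have h2 : (k : ℤ) + j ≠ 0 := by omega
    by_cases h : k = j
    · subst h
      simp only [sub_self, if_true, if_neg h2]; ring
    · have h1 : (k : ℤ) - j ≠ 0 := by omega
      simp only [if_neg h, if_neg h1, if_neg h2]; ring
  all_goals exact Continuous.intervalIntegrable (by fun_prop) _ _

variable {f : ℝ → ℝ} {a b u : ℕ → ℝ}

lemma hasSum_integral_mul_of_hasSum (hu : Summable u) (ha : ∀ k, |a k| ≤ u k)
    (hb : ∀ k, |b k| ≤ u k)
    (hf : ∀ x, HasSum (fun k : ℕ => a k * cos (k * x) + b k * sin (k * x)) (f x))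
    {g : ℝ → ℝ} (hg : Continuous g) (hg1 : ∀ x, |g x| ≤ 1) :
    HasSum (fun k : ℕ => ∫ t in (-π)..π, (a k * cos (k * t) + b k * sin (k * t)) * g t)
      (∫ t in (-π)..π, f t * g t) := by
  refine intervalIntegral.hasSum_integral_of_dominated_convergence (fun k _ => u k + u k)
    (fun k => (by fun_prop : Continuous fun t : ℝ =>
      (a k * cos (k * t) + b k * sin (k * t)) * g t).aestronglyMeasurable)
    (fun k => ae_of_all _ fun t _ => ?_) (ae_of_all _ fun t _ => hu.add hu)
    (by simp) (ae_of_all _ fun t _ => (hf t).mul_right (g t))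
  have hu0 : 0 ≤ u k := (abs_nonneg _).trans (ha k)
  rw [norm_mul, Real.norm_eq_abs, Real.norm_eq_abs, ← mul_one (u k + u k)]
  refine mul_le_mul ((abs_add_le _ _).trans (add_le_add ?_ ?_)) (hg1 t) (abs_nonneg _)
    (by positivity) <;> rw [abs_mul, ← mul_one (u k)]
  · exact mul_le_mul (ha k) (abs_cos_le_one _) (abs_nonneg _) hu0
  · exact mul_le_mul (hb k) (abs_sin_le_one _) (abs_nonneg _) hu0

/-- The Fourier sums of the sum of an absolutely convergent trigonometric series. -/
lemma fourierSum_eq_of_hasSum (hu : Summable u) (ha : ∀ k, |a k| ≤ u k)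
    (hb : ∀ k, |b k| ≤ u k)
    (hf : ∀ x, HasSum (fun k : ℕ => a k * cos (k * x) + b k * sin (k * x)) (f x))
    (n : ℕ) (x : ℝ) :
    fourierSum n f x = a 0 + ∑ j ∈ Finset.Icc 1 n, (a j * cos (j * x) + b j * sin (j * x)) := by
  have hcos : ∀ j : ℕ, fourierCos f j = if j = 0 then 2 * a 0 else a j := fun j => by
    have h1 := hasSum_integral_mul_of_hasSum hu ha hb hf
      (g := fun t => cos (j * t)) (by fun_prop) (fun t => abs_cos_le_one _)
    simp_rw [integral_harmonic_mul_cos] at h1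
    have h2 := (hasSum_ite_eq j (if j = 0 then 2 * π * a j else π * a j))
    have h3 : (fun k => if k = j then (if j = 0 then 2 * π * a k else π * a k) else 0)
        = fun k => if k = j then (if j = 0 then 2 * π * a j else π * a j) else 0 := by
      funext k; by_cases h : k = j <;> simp [h]
    rw [h3] at h1
    unfold fourierCos
    rw [h1.unique h2]
    split_ifs with h
    · subst h; field_simp
    · field_simp
  have hsin : ∀ j : ℕ, j ≠ 0 → fourierSin f j = b j := fun j hj => by
    have h1 := hasSum_integral_mul_of_hasSum hu ha hb hf
      (g := fun t => sin (j * t)) (by fun_prop) (fun t => abs_sin_le_one _)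
    simp_rw [integral_harmonic_mul_sin _ _ _ hj] at h1
    have h2 := (hasSum_ite_eq j (π * b j))
    have h3 : (fun k => if k = j then π * b k else 0)
        = fun k => if k = j then π * b j else 0 := by
      funext k; by_cases h : k = j <;> simp [h]
    rw [h3] at h1
    unfold fourierSin
    rw [h1.unique h2]
    field_simp
  unfold fourierSum
  rw [hcos 0, if_pos rfl, mul_div_cancel_left₀ _ (two_ne_zero)]
  congr 1
  refine Finset.sum_congr rfl fun j hj => ?_
  have hj0 : j ≠ 0 := by have := (Finset.mem_Icc.1 hj).1; omega
  rw [hcos j, if_neg hj0, hsin j hj0]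

end FourierCoefficients

/-! ### Closed forms for the Poisson kernel and its averaged tails. -/

section PoissonKernel

variable {q : ℝ} (h0 : 0 < q) (h1 : q < 1)

lemma pow_mul_cos_eq_re (q γ t : ℝ) (j : ℕ) : q ^ j * cos (j * t + γ)
    = ((q * Complex.exp (t * Complex.I)) ^ j * Complex.exp (γ * Complex.I)).re := by
  rw [mul_pow, ← Complex.exp_nat_mul, mul_assoc, ← Complex.exp_add,
    show (j : ℂ) * (t * Complex.I) + γ * Complex.I = ((j * t + γ : ℝ) : ℂ) * Complex.I by
      push_cast; ring, ← Complex.ofReal_pow, Complex.re_ofReal_mul, Complex.exp_ofReal_mul_I_re]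

include h0 h1

lemma norm_mul_exp_lt_one (t : ℝ) : ‖(q : ℂ) * Complex.exp (t * Complex.I)‖ < 1 := by
  rwa [norm_mul, Complex.norm_exp_ofReal_mul_I, mul_one, Complex.norm_real, Real.norm_eq_abs,
    abs_of_pos h0]

lemma hasSum_poissonKernel (β t : ℝ) :
    HasSum (fun k : ℕ => q ^ (k + 1) * cos (((k + 1 : ℕ) : ℝ) * t + β * π / 2))
      (poissonKernel q β t) := by
  refine Summable.hasSum (Summable.of_norm_bounded (g := fun k : ℕ => q ^ (k + 1)) ?_ fun k => ?_)
  · exact (summable_nat_add_iff 1).2 (summable_geometric_of_lt_one h0.le h1)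
  · rw [norm_mul, Real.norm_eq_abs, Real.norm_eq_abs, abs_of_pos (by positivity : 0 < q ^ (k + 1))]
    exact mul_le_of_le_one_right (by positivity) (abs_cos_le_one _)

lemma poissonKernel_eq_re (β t : ℝ) :
    poissonKernel q β t = (q * Complex.exp (t * Complex.I) * Complex.exp ((β * π / 2 : ℝ) *
      Complex.I) / (1 - q * Complex.exp (t * Complex.I))).re := by
  have hz := norm_mul_exp_lt_one h0 h1 t
  refine (hasSum_poissonKernel h0 h1 β t).unique ?_
  simp_rw [pow_mul_cos_eq_re]
  set z := (q : ℂ) * Complex.exp (t * Complex.I)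
  have := ((hasSum_geometric_of_norm_lt_one hz).mul_left z).mul_right
    (Complex.exp ((β * π / 2 : ℝ) * Complex.I))
  convert Complex.hasSum_re this using 2
  · rename_i k
    rw [pow_succ']
  · rw [div_eq_mul_inv]; ring

lemma poissonKernel_sub_sum (β t : ℝ) (k : ℕ) :
    poissonKernel q β t - ∑ j ∈ Finset.Icc 1 k, q ^ j * cos (j * t + β * π / 2)
      = ((q * Complex.exp (t * Complex.I)) ^ (k + 1) * Complex.exp ((β * π / 2 : ℝ) *
        Complex.I) / (1 - q * Complex.exp (t * Complex.I))).re := by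
  have hz := norm_mul_exp_lt_one h0 h1 t
  induction k with
  | zero => simp [poissonKernel_eq_re h0 h1]
  | succ k ih =>
    rw [Finset.sum_Icc_succ_top (by omega), ← sub_sub, ih, pow_mul_cos_eq_re, ← Complex.sub_re]
    congr 1
    have : 1 - (q : ℂ) * Complex.exp (t * Complex.I) ≠ 0 := by
      intro h
      rw [← sub_eq_zero.1 h, norm_one] at hz
      exact lt_irrefl _ hz
    field_simp
    ring

lemma continuous_poissonKernel (β : ℝ) : Continuous (poissonKernel q β) := by
  rw [funext (poissonKernel_eq_re h0 h1 β)]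
  refine Complex.continuous_re.comp (Continuous.div (by fun_prop) (by fun_prop) fun t h => ?_)
  have hz := norm_mul_exp_lt_one h0 h1 t
  rw [← sub_eq_zero.1 h, norm_one] at hz
  exact lt_irrefl _ hz

/-- The tails z^{k+1}/(1 - z) for n-p ≤ k < n sum to z^{n-p+1}(1 - z^p)/(1 - z)^2; polar form of the
second factor gives amplitude and phase. -/
lemma sum_poissonKernel_sub_sum (β t : ℝ) {n p : ℕ} (hp : 0 < p) (hpn : p < n) :
    ∑ k ∈ Finset.Ico (n - p) n,
        (poissonKernel q β t - ∑ j ∈ Finset.Icc 1 k, q ^ j * cos (j * t + β * π / 2))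
      = q ^ (n - p + 1) * (kernelAmp q (β * π / 2) p t *
          cos ((n - p + 1 : ℕ) * t + (kernelLog q (β * π / 2) p t).im)) := by
  simp_rw [poissonKernel_sub_sum h0 h1]
  have hne := oneSubExp_ne_zero h0.le h1 1 t
  have e1 : oneSubExp q 1 t = 1 - q * Complex.exp (t * Complex.I) := by
    simp [oneSubExp]
  have e2 : oneSubExp (q ^ p) p t = 1 - (q * Complex.exp (t * Complex.I)) ^ p := by
    unfold oneSubExp
    rw [mul_pow, ← Complex.exp_nat_mul]
    push_cast
    ring_nf
  have e3 : kernelAmp q (β * π / 2) p t * cos ((n - p + 1 : ℕ) * t +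
      (kernelLog q (β * π / 2) p t).im) = (Complex.exp (kernelLog q (β * π / 2) p t) *
        Complex.exp (t * Complex.I) ^ (n - p + 1)).re := by
    rw [← Complex.exp_nat_mul, ← Complex.exp_add, Complex.exp_re, kernelAmp]
    simp [add_comm]
  rw [e3, exp_kernelLog h0 h1 _ hp, ← Complex.re_ofReal_mul, ← Complex.re_sum]
  congr 1
  rw [Finset.sum_Ico_eq_sum_range, show n - (n - p) = p by omega, e2]
  rw [e1] at hne ⊢
  push_cast
  set w := Complex.exp (t * Complex.I)
  set v := Complex.exp ((β : ℂ) * π / 2 * Complex.I)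
  have hg := mul_neg_geom_sum ((q : ℂ) * w) p
  rw [← hg]
  have e4 : ∀ k ∈ Finset.range p, ((q : ℂ) * w) ^ (n - p + k + 1) * v / (1 - q * w)
      = (q * w) ^ (n - p + 1) * v / (1 - q * w) * (q * w) ^ k := fun k _ => by
    rw [show n - p + k + 1 = (n - p + 1) + k by ring, pow_add]
    ring
  rw [Finset.sum_congr rfl e4, ← Finset.mul_sum, mul_pow _ _ (n - p + 1)]
  field_simp

end PoissonKernel

/-! ### Integral representation of the deviation. -/

section Representation

variable {q : ℝ} (h0 : 0 < q) (h1 : q < 1)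

/-- The frequency `j` component of the convolution of `φ`. -/
lemma integral_mul_cos_eq {φ : ℝ → ℝ} (hφ : Continuous φ) (hper : Function.Periodic φ (2 * π))
    (γ x : ℝ) (j : ℕ) :
    ∫ t in (0 : ℝ)..(2 * π), φ (x + t) * cos (j * t + γ)
      = (∫ s in (0 : ℝ)..(2 * π), φ s * cos (j * s + γ)) * cos (j * x)
        + (∫ s in (0 : ℝ)..(2 * π), φ s * sin (j * s + γ)) * sin (j * x) := by
  have e1 : ∫ t in (0 : ℝ)..(2 * π), φ (x + t) * cos (j * t + γ)
      = ∫ s in x..(x + 2 * π), φ s * cos (j * (s - x) + γ) := by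
    have := intervalIntegral.integral_comp_add_left (a := 0) (b := 2 * π)
      (fun s => φ s * cos (j * (s - x) + γ)) x
    rw [add_zero] at this
    rw [← this]
    refine intervalIntegral.integral_congr fun t _ => ?_
    simp only [add_sub_cancel_left]
  have hp : Function.Periodic (fun s => φ s * cos (j * (s - x) + γ)) (2 * π) := fun s => by
    simp only [hper s]
    rw [show (j : ℝ) * (s + 2 * π - x) + γ = j * (s - x) + γ + j * (2 * π) by ring,
      cos_add_nat_mul_two_pi]
  rw [e1, hp.intervalIntegral_add_eq x 0, zero_add, ← intervalIntegral.integral_mul_const,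
    ← intervalIntegral.integral_mul_const, ← intervalIntegral.integral_add]
  · refine intervalIntegral.integral_congr fun s _ => ?_
    rw [show (j : ℝ) * (s - x) + γ = (j * s + γ) - j * x by ring, cos_sub]
    ring
  all_goals exact Continuous.intervalIntegrable (by fun_prop) _ _

include h0 h1

lemma hasSum_integral_poissonKernel {φ : ℝ → ℝ} {W : ℝ} (hφ : Continuous φ)
    (hW : ∀ t, |φ t| ≤ W) (β x : ℝ) :
    HasSum (fun k : ℕ => q ^ (k + 1) *
        ∫ t in (0 : ℝ)..(2 * π), φ (x + t) * cos (((k + 1 : ℕ) : ℝ) * t + β * π / 2))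
      (∫ t in (0 : ℝ)..(2 * π), φ (x + t) * poissonKernel q β t) := by
  have hW0 : 0 ≤ W := (abs_nonneg _).trans (hW 0)
  have key := intervalIntegral.hasSum_integral_of_dominated_convergence (μ := volume)
    (a := 0) (b := 2 * π)
    (F := fun (k : ℕ) t => φ (x + t) * (q ^ (k + 1) * cos (((k + 1 : ℕ) : ℝ) * t + β * π / 2)))
    (f := fun t => φ (x + t) * poissonKernel q β t)
    (fun k _ => W * q ^ (k + 1))
    (fun k => Continuous.aestronglyMeasurable (by fun_prop))
    (fun k => ae_of_all _ fun t _ => ?_)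
    (ae_of_all _ fun t _ =>
      ((summable_nat_add_iff 1).2 (summable_geometric_of_lt_one h0.le h1)).mul_left W)
    (by simp) (ae_of_all _ fun t _ => (hasSum_poissonKernel h0 h1 β t).mul_left _)
  · refine key.congr_fun fun k => ?_
    rw [← intervalIntegral.integral_const_mul]
    refine intervalIntegral.integral_congr fun t _ => ?_
    ring
  · rw [norm_mul, norm_mul, Real.norm_eq_abs, Real.norm_eq_abs, Real.norm_eq_abs,
      abs_of_pos (by positivity : 0 < q ^ (k + 1))]
    exact mul_le_mul (hW _) (mul_le_of_le_one_right (by positivity) (abs_cos_le_one _))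
      (by positivity) hW0

/-- Convolution with the kernel multiplies each harmonic of φ by a geometrically decaying factor, so
f is an absolutely convergent trigonometric series and its Fourier sum truncates the kernel. -/
lemma sub_fourierSum {φ : ℝ → ℝ} {W : ℝ} (hφ : Continuous φ) (hper : Function.Periodic φ (2 * π))
    (hW : ∀ t, |φ t| ≤ W) (β A₀ : ℝ) {f : ℝ → ℝ}
    (hf : ∀ x, f x = A₀ + 1 / π * ∫ t in (0 : ℝ)..(2 * π), φ (x + t) * poissonKernel q β t)
    (n : ℕ) (x : ℝ) :
    f x - fourierSum n f x = 1 / π * ∫ t in (0 : ℝ)..(2 * π), φ (x + t) *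
      (poissonKernel q β t - ∑ j ∈ Finset.Icc 1 n, q ^ j * cos (j * t + β * π / 2)) := by
  have hW0 : 0 ≤ W := (abs_nonneg _).trans (hW 0)
  set γ := β * π / 2 with hγ
  set A : ℕ → ℝ := fun j => ∫ s in (0 : ℝ)..(2 * π), φ s * cos (j * s + γ) with hA
  set B : ℕ → ℝ := fun j => ∫ s in (0 : ℝ)..(2 * π), φ s * sin (j * s + γ) with hB
  have hAb : ∀ j, |A j| ≤ W * (2 * π) := fun j => abs_integral_le_of_abs_le fun t => by
    rw [abs_mul, ← mul_one W]
    exact mul_le_mul (hW t) (abs_cos_le_one _) (abs_nonneg _) hW0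
  have hBb : ∀ j, |B j| ≤ W * (2 * π) := fun j => abs_integral_le_of_abs_le fun t => by
    rw [abs_mul, ← mul_one W]
    exact mul_le_mul (hW t) (abs_sin_le_one _) (abs_nonneg _) hW0
  -- The kernel has no constant harmonic, so the coefficient at 0 is A₀. The value of `b 0` is
  -- immaterial, since it multiplies sin 0.
  set a : ℕ → ℝ := fun k => if k = 0 then A₀ else 1 / π * (q ^ k * A k) with ha
  set b : ℕ → ℝ := fun k => 1 / π * (q ^ k * B k) with hb
  set u : ℕ → ℝ := fun k => (|A₀| + 1 / π * (W * (2 * π))) * q ^ k with hu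
  have hbound : ∀ (k : ℕ) (y : ℝ), |y| ≤ W * (2 * π) → |1 / π * (q ^ k * y)| ≤ u k := by
    intro k y hy
    rw [abs_mul, abs_mul, abs_of_pos (by positivity : 0 < 1 / π),
      abs_of_pos (by positivity : 0 < q ^ k)]
    have : 1 / π * (q ^ k * |y|) ≤ 1 / π * (q ^ k * (W * (2 * π))) := by gcongr
    have h2 : 0 ≤ |A₀| * q ^ k := by positivity
    simp only [hu]
    linarith
  have hau : ∀ k, |a k| ≤ u k := fun k => by
    rcases eq_or_ne k 0 with h | h
    · subst h
      simp only [ha, hu, if_true, pow_zero, mul_one]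
      have : 0 ≤ 1 / π * (W * (2 * π)) := by positivity
      linarith
    · simp only [ha, if_neg h]
      exact hbound k _ (hAb k)
  have hbu : ∀ k, |b k| ≤ u k := fun k => hbound k _ (hBb k)
  have husum : Summable u := (summable_geometric_of_lt_one h0.le h1).mul_left _
  have hcomp : ∀ (j : ℕ) (x : ℝ), j ≠ 0 → a j * cos (j * x) + b j * sin (j * x)
      = 1 / π * (q ^ j * ∫ t in (0 : ℝ)..(2 * π), φ (x + t) * cos (j * t + γ)) := by
    intro j x hj
    rw [integral_mul_cos_eq hφ hper]
    simp only [ha, hb, if_neg hj, hA, hB]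
    ring
  have hfs : ∀ x, HasSum (fun k : ℕ => a k * cos (k * x) + b k * sin (k * x)) (f x) := fun x => by
    rw [← hasSum_nat_add_iff' 1]
    have e : f x - ∑ i ∈ Finset.range 1, (a i * cos (i * x) + b i * sin (i * x))
        = 1 / π * ∫ t in (0 : ℝ)..(2 * π), φ (x + t) * poissonKernel q β t := by
      simp [ha, hf x]
    rw [e]
    refine ((hasSum_integral_poissonKernel h0 h1 hφ hW β x).mul_left (1 / π)).congr_fun fun k => ?_
    exact hcomp (k + 1) x (by omega)
  rw [fourierSum_eq_of_hasSum husum hau hbu hfs, hf x]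
  have hPc := continuous_poissonKernel h0 h1 β
  have e2 : ∑ j ∈ Finset.Icc 1 n, (a j * cos (j * x) + b j * sin (j * x))
      = 1 / π * ∫ t in (0 : ℝ)..(2 * π), φ (x + t) *
        ∑ j ∈ Finset.Icc 1 n, q ^ j * cos (j * t + γ) := by
    simp_rw [Finset.mul_sum]
    rw [intervalIntegral.integral_finsetSum, Finset.mul_sum]
    · refine Finset.sum_congr rfl fun j hj => ?_
      rw [hcomp j x (by have := (Finset.mem_Icc.1 hj).1; omega),
        ← intervalIntegral.integral_const_mul]
      congr 1
      refine intervalIntegral.integral_congr fun t _ => ?_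
      ring
    · intro j _
      exact Continuous.intervalIntegrable (by fun_prop) _ _
  have e3 : a 0 = A₀ := by simp [ha]
  have i1 : IntervalIntegrable (fun t => φ (x + t) * poissonKernel q β t) volume 0 (2 * π) :=
    Continuous.intervalIntegrable (by fun_prop) _ _
  have i2 : IntervalIntegrable (fun t => φ (x + t) *
      ∑ j ∈ Finset.Icc 1 n, q ^ j * cos (j * t + γ)) volume 0 (2 * π) :=
    Continuous.intervalIntegrable (by fun_prop) _ _
  simp_rw [mul_sub]
  rw [e2, e3, intervalIntegral.integral_sub i1 i2]
  ring

lemma sub_valleePoussin {φ : ℝ → ℝ} {W : ℝ} (hφ : Continuous φ)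
    (hper : Function.Periodic φ (2 * π)) (hW : ∀ t, |φ t| ≤ W) (β A₀ : ℝ) {f : ℝ → ℝ}
    (hf : ∀ x, f x = A₀ + 1 / π * ∫ t in (0 : ℝ)..(2 * π), φ (x + t) * poissonKernel q β t)
    {n p : ℕ} (hp : 0 < p) (hpn : p < n) (x : ℝ) :
    f x - valleePoussin n p f x = q ^ (n - p + 1) / p * (1 / π * ∫ t in (0 : ℝ)..(2 * π),
      φ (x + t) * (kernelAmp q (β * π / 2) p t *
        cos ((n - p + 1 : ℕ) * t + (kernelLog q (β * π / 2) p t).im))) := by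
  have hp' : (p : ℝ) ≠ 0 := by exact_mod_cast hp.ne'
  have hPc := continuous_poissonKernel h0 h1 β
  have e1 : f x - valleePoussin n p f x
      = 1 / (p : ℝ) * ∑ k ∈ Finset.Ico (n - p) n, (f x - fourierSum k f x) := by
    unfold valleePoussin
    rw [Finset.sum_sub_distrib, Finset.sum_const, Nat.card_Ico, show n - (n - p) = p by omega,
      nsmul_eq_mul, mul_sub, ← mul_assoc, one_div_mul_cancel hp', one_mul]
  rw [e1]
  simp_rw [sub_fourierSum h0 h1 hφ hper hW β A₀ hf]
  rw [← Finset.mul_sum, ← intervalIntegral.integral_finsetSum fun k _ =>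
    Continuous.intervalIntegrable (by fun_prop) _ _]
  simp_rw [← Finset.mul_sum, sum_poissonKernel_sub_sum h0 h1 β _ hp hpn]
  have e2 : ∫ t in (0 : ℝ)..(2 * π), φ (x + t) * (q ^ (n - p + 1) *
        (kernelAmp q (β * π / 2) p t *
          cos ((n - p + 1 : ℕ) * t + (kernelLog q (β * π / 2) p t).im)))
      = q ^ (n - p + 1) * ∫ t in (0 : ℝ)..(2 * π), φ (x + t) * (kernelAmp q (β * π / 2) p t *
          cos ((n - p + 1 : ℕ) * t + (kernelLog q (β * π / 2) p t).im)) := by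
    rw [← intervalIntegral.integral_const_mul]
    refine intervalIntegral.integral_congr fun t _ => ?_
    ring
  rw [e2]
  ring

/-- The representation applied to φ = 1: the kernel has mean zero, so f = 0 and its deviation
vanishes. -/
lemma integral_kernel_eq_zero (β : ℝ) {n p : ℕ} (hp : 0 < p) (hpn : p < n) :
    ∫ t in (0 : ℝ)..(2 * π), kernelAmp q (β * π / 2) p t *
        cos ((n - p + 1 : ℕ) * t + (kernelLog q (β * π / 2) p t).im) = 0 := by
  have hP : ∫ t in (0 : ℝ)..(2 * π), (1 : ℝ) * poissonKernel q β t = 0 := by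
    have hs := hasSum_integral_poissonKernel h0 h1 (φ := fun _ => 1) (W := 1) continuous_const
      (fun _ => by simp) β 0
    refine hs.unique ?_
    convert hasSum_zero using 2
    rename_i k
    have hk : ((k + 1 : ℕ) : ℝ) ≠ 0 := by positivity
    simp only [one_mul]
    rw [intervalIntegral.integral_comp_mul_add _ hk, integral_cos, add_comm _ (β * π / 2),
      sin_add_nat_mul_two_pi]
    simp
  have key := sub_valleePoussin h0 h1 (φ := fun _ => 1) (W := 1) continuous_const
    (fun _ => rfl) (fun _ => by simp) β 0 (f := fun _ => 0) (fun x => by rw [hP]; simp) hp hpn 0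
  have e : valleePoussin n p (fun _ => 0) 0 = 0 := by
    simp [valleePoussin, fourierSum, fourierCos, fourierSin]
  simp only [e, one_mul, sub_zero] at key
  have hp' : (0 : ℝ) < p := by exact_mod_cast hp
  have c1 : q ^ (n - p + 1) / p ≠ 0 := by positivity
  have c2 : (1 / π : ℝ) ≠ 0 := by positivity
  have k1 := (mul_eq_zero.1 key.symm).resolve_left c1
  exact (mul_eq_zero.1 k1).resolve_left c2

end Representation

end PoissonVP

namespace PoissonVP

variable {ω : ℝ → ℝ} {q : ℝ}

lemma two_le_expDelta (p : ℕ) : 2 ≤ expDelta p := by unfold expDelta; split_ifs <;> norm_num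

lemma expDelta_le_three (p : ℕ) : expDelta p ≤ 3 := by unfold expDelta; split_ifs <;> norm_num

lemma comp_const_add_mem_classH {φ : ℝ → ℝ} (hφ : φ ∈ classH ω) (x : ℝ) :
    (fun t => φ (x + t)) ∈ classH ω := by
  obtain ⟨hc, hp, hm⟩ := hφ
  refine ⟨by fun_prop, fun t => ?_, fun s t => ?_⟩
  · simp only [← add_assoc, hp (x + t)]
  · simpa using hm (x + s) (x + t)

lemma exists_bound_of_mem_classH (h : IsModulusOfContinuity ω) {φ : ℝ → ℝ} (hφ : φ ∈ classH ω) :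
    ∃ W, ∀ t, |φ t| ≤ W := by
  refine ⟨ω π + |φ 0|, fun t => ?_⟩
  have h1 := abs_sub_le_of_mem_classH h hφ t
  have h2 := abs_add_le (φ t - φ 0) (φ 0)
  rw [sub_add_cancel] at h2
  linarith

lemma periodic_kernelAmp (q γ : ℝ) (p : ℕ) : Function.Periodic (kernelAmp q γ p) (2 * π) := fun t => by
  unfold kernelAmp; rw [periodic_kernelLog q γ p t]

/-! ### The two-sided formula for the deviation. -/

section Formula

variable (h0 : 0 < q) (h1 : q < 1) (β : ℝ) {n p : ℕ} (hp : 0 < p) (hpn : p < n)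
  (h : IsConvexUpwardModulus ω)
include h0 h1 hp

lemma abs_kernelAmp_le (γ t : ℝ) : |kernelAmp q γ p t| ≤ 2 / (1 - q) ^ (expDelta p - 1) :=
  (abs_of_pos (exp_pos _)).trans_le (kernelAmp_le h0 h1 γ hp t)

lemma abs_kernelAmp_mul_re_le (γ t : ℝ) : |kernelAmp q γ p t * (kernelLogDeriv q p t).re|
    ≤ 2 / (1 - q) ^ (expDelta p - 1) * (3 / (1 - q)) := by
  rw [abs_mul]
  have hD : 0 < 1 - q := by linarith
  exact mul_le_mul (abs_kernelAmp_le h0 h1 hp γ t)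
    ((Complex.abs_re_le_norm _).trans (norm_kernelLogDeriv_le h0 h1 hp t)) (abs_nonneg _)
    (by positivity)

lemma abs_kernelLogDeriv_im_le (t : ℝ) : |(kernelLogDeriv q p t).im| ≤ 3 / (1 - q) :=
  (Complex.abs_im_le_norm _).trans (norm_kernelLogDeriv_le h0 h1 hp t)

omit hp h0 in
-- With B = 2/(1-q)^{δ-1}, E = 3/(1-q) and B' = BE, the error 100(B' + BE)/π is 1200/π times
-- (1-q)^{-δ}; as π > 3, the absolute constant is 400.
lemma error_term_le (hω : 0 ≤ ω π) (n p : ℕ) :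
    1 / π * (100 * ω π * (2 / (1 - q) ^ (expDelta p - 1) * (3 / (1 - q))
      + 2 / (1 - q) ^ (expDelta p - 1) * (3 / (1 - q))) / ((n - p + 1 : ℕ) : ℝ))
      ≤ 400 * remainderTerm q ω n p := by
  have hD : 0 < 1 - q := by linarith
  have e : (1 - q) ^ expDelta p = (1 - q) ^ (expDelta p - 1) * (1 - q) := by
    rw [← pow_succ]
    congr 1
    have := two_le_expDelta p
    omega
  unfold remainderTerm
  rw [e]
  set d := (1 - q) ^ (expDelta p - 1) with hd
  have hd0 : 0 < d := by positivity
  have hM : (0 : ℝ) < ((n - p + 1 : ℕ) : ℝ) := by positivity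
  rw [show 1 / π * (100 * ω π * (2 / d * (3 / (1 - q)) + 2 / d * (3 / (1 - q)))
      / ((n - p + 1 : ℕ) : ℝ)) = 1200 / π * (ω π / (d * (1 - q) * ((n - p + 1 : ℕ) : ℝ))) by
    field_simp; ring]
  refine mul_le_mul_of_nonneg_right ?_ (by positivity)
  rw [div_le_iff₀ pi_pos]
  linarith [pi_gt_three]

include hpn h

lemma abs_sub_valleePoussin_le {f : ℝ → ℝ} (hf : f ∈ poissonClass q β (classH ω)) (x : ℝ) :
    |f x - valleePoussin n p f x|
      ≤ q ^ (n - p + 1) / p * (principalTerm q ω n p + 400 * remainderTerm q ω n p) := by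
  obtain ⟨A₀, φ, hφ, hf⟩ := hf
  have hm := h.toIsModulusOfContinuity
  obtain ⟨W, hW⟩ := exists_bound_of_mem_classH hm hφ
  rw [sub_valleePoussin h0 h1 hφ.1 hφ.2.1 hW β A₀ hf hp hpn x]
  have hc : 0 ≤ q ^ (n - p + 1) / p := by positivity
  rw [abs_mul, abs_of_nonneg hc, abs_mul, abs_of_pos (by positivity : 0 < 1 / π)]
  refine mul_le_mul_of_nonneg_left ?_ hc
  have hmain := abs_integral_le_of_mem_classH h (M := n - p + 1)
    (comp_const_add_mem_classH hφ x) (Nat.succ_pos _)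
    (hasDerivAt_kernelAmp h0 h1 (β * π / 2) hp) (hasDerivAt_kernelLog_im h0 h1 (β * π / 2) hp)
    (periodic_kernelAmp q _ p)
    (fun t => by simp only [periodic_kernelLog q (β * π / 2) p t])
    (fun t => (exp_pos _).le) (abs_kernelAmp_le h0 h1 hp _) (abs_kernelAmp_mul_re_le h0 h1 hp _)
    (abs_kernelLogDeriv_im_le h0 h1 hp) (integral_kernel_eq_zero h0 h1 β hp hpn)
  rw [integral_kernelAmp h0 h1 _ hp] at hmain
  have h2 := mul_le_mul_of_nonneg_left hmain (by positivity : 0 ≤ 1 / π)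
  refine h2.trans ?_
  rw [mul_add]
  refine add_le_add (le_of_eq ?_) (error_term_le h1 (hm.nonneg pi_pos.le) n p)
  unfold principalTerm
  ring

lemma exists_sub_valleePoussin_ge : ∃ f ∈ poissonClass q β (classH ω),
    q ^ (n - p + 1) / p * (principalTerm q ω n p - 400 * remainderTerm q ω n p)
      ≤ |f 0 - valleePoussin n p f 0| := by
  have hm := h.toIsModulusOfContinuity
  obtain ⟨φ, hφ, hge⟩ := exists_mem_classH_integral_ge h (M := n - p + 1) (Nat.succ_pos _)
    (hasDerivAt_kernelAmp h0 h1 (β * π / 2) hp)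
    ((continuous_iff_continuousAt.2 fun t =>
      (hasDerivAt_kernelAmp h0 h1 (β * π / 2) hp t).continuousAt).mul
      (Complex.continuous_re.comp (continuous_kernelLogDeriv h0 h1 hp)))
    (hasDerivAt_kernelLog_im h0 h1 (β * π / 2) hp)
    (Complex.continuous_im.comp (continuous_kernelLogDeriv h0 h1 hp))
    (periodic_kernelAmp q _ p)
    (fun t => by simp only [periodic_kernelLog q (β * π / 2) p t])
    (fun t => (exp_pos _).le) (abs_kernelAmp_le h0 h1 hp _) (abs_kernelAmp_mul_re_le h0 h1 hp _)
    (abs_kernelLogDeriv_im_le h0 h1 hp)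
  refine ⟨fun x => 0 + 1 / π * ∫ t in (0 : ℝ)..(2 * π), φ (x + t) * poissonKernel q β t,
    ⟨0, φ, hφ, fun x => rfl⟩, ?_⟩
  obtain ⟨W, hW⟩ := exists_bound_of_mem_classH hm hφ
  rw [sub_valleePoussin h0 h1 hφ.1 hφ.2.1 hW β 0 (fun x => rfl) hp hpn 0]
  refine le_trans ?_ (le_abs_self _)
  refine mul_le_mul_of_nonneg_left ?_ (by positivity)
  simp only [zero_add]
  rw [integral_kernelAmp h0 h1 _ hp] at hge
  refine le_trans ?_ (mul_le_mul_of_nonneg_left hge (by positivity : 0 ≤ 1 / π))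
  rw [mul_sub]
  refine sub_le_sub (le_of_eq ?_) (error_term_le h1 (hm.nonneg pi_pos.le) n p)
  unfold principalTerm
  ring

lemma deviation_poissonClass :
    deviation (poissonClass q β (classH ω)) n p ≠ ⊤ ∧
      |(deviation (poissonClass q β (classH ω)) n p).toReal
          - q ^ (n - p + 1) / p * principalTerm q ω n p|
        ≤ q ^ (n - p + 1) / p * (400 * remainderTerm q ω n p) := by
  set c := q ^ (n - p + 1) / (p : ℝ) with hc
  have hup : deviation (poissonClass q β (classH ω)) n p
      ≤ ENNReal.ofReal (c * (principalTerm q ω n p + 400 * remainderTerm q ω n p)) := by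
    refine iSup₂_le fun f hf => iSup_le fun x => ?_
    rw [Real.enorm_eq_ofReal_abs]
    exact ENNReal.ofReal_le_ofReal (abs_sub_valleePoussin_le h0 h1 β hp hpn h hf x)
  have htop := ne_top_of_le_ne_top ENNReal.ofReal_ne_top hup
  obtain ⟨f, hf, hge⟩ := exists_sub_valleePoussin_ge h0 h1 β hp hpn h
  have hlow : ENNReal.ofReal |f 0 - valleePoussin n p f 0|
      ≤ deviation (poissonClass q β (classH ω)) n p := by
    rw [← Real.enorm_eq_ofReal_abs]
    exact (le_iSup (fun x => ‖f x - valleePoussin n p f x‖ₑ) 0).trans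
      (le_iSup₂ (f := fun f (_ : f ∈ poissonClass q β (classH ω)) =>
        uniformNorm fun x => f x - valleePoussin n p f x) f hf)
  refine ⟨htop, ?_⟩
  have hlow' := (ENNReal.ofReal_le_iff_le_toReal htop).1 hlow
  have hnn := (abs_nonneg _).trans (abs_sub_valleePoussin_le h0 h1 β hp hpn h hf 0)
  have hup' := ENNReal.toReal_le_of_le_ofReal hnn hup
  rw [abs_le]
  constructor <;> linarith

end Formula

/-! ### When the remainder is negligible. -/

section Asymptotics

lemma IsConvexUpwardModulus.div_le_div (h : IsConvexUpwardModulus ω) {s t : ℝ} (hs : 0 < s)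
    (hst : s ≤ t) : ω t / t ≤ ω s / s := by
  have ht : 0 < t := hs.trans_le hst
  have := h.mul_le ((one_le_div hs).2 hst) hs.le
  rw [div_mul_cancel₀ _ hs.ne'] at this
  rw [div_le_iff₀ ht]
  refine this.trans (le_of_eq ?_)
  ring

lemma IsConvexUpwardModulus.pos (h : IsConvexUpwardModulus ω) (hne : ∃ t : ℝ, 0 < t ∧ ω t ≠ 0)
    {x : ℝ} (hx : 0 < x) : 0 < ω x := by
  obtain ⟨t, ht, htne⟩ := hne
  have hm := h.toIsModulusOfContinuity
  have h1 : 0 < ω t := lt_of_le_of_ne (hm.nonneg ht.le) htne.symm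
  rcases le_total t x with htx | hxt
  · exact h1.trans_le (hm.mono ht.le htx)
  · have := (div_pos h1 ht).trans_le (h.div_le_div hx hxt)
    exact (div_pos_iff_of_pos_right hx).1 this

/-- Calibrates e_m on linear moduli: ω(s) = Ns gives 2N/m. -/
lemma integral_mul_sin (c : ℝ) : ∫ t in (0 : ℝ)..(π / 2), c * t * sin t = c := by
  have hd : ∀ t ∈ uIcc 0 (π / 2),
      HasDerivAt (fun t => c * (sin t - t * cos t)) (c * t * sin t) t := fun t _ => by
    have := ((hasDerivAt_sin t).sub ((hasDerivAt_id t).mul (hasDerivAt_cos t))).const_mul c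
    rw [show c * t * sin t = c * (cos t - (1 * cos t + id t * -sin t)) by simp only [id]; ring]
    exact this
  rw [intervalIntegral.integral_eq_sub_of_hasDerivAt hd
    (Continuous.intervalIntegrable (by fun_prop) _ _)]
  simp

lemma le_modulusE (h : IsModulusOfContinuity ω) {m : ℕ} (hm : 0 < m) {N : ℝ}
    (hN : ∀ s, 0 < s → s ≤ π / m → N * s ≤ ω s) : 2 * N / m ≤ modulusE m ω := by
  have hm' : (0 : ℝ) < m := by exact_mod_cast hm
  rw [modulusE_eq, ← integral_mul_sin (2 * N / m)]
  refine intervalIntegral.integral_mono_on (by positivity)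
    (Continuous.intervalIntegrable (by fun_prop) _ _)
    ((continuous_modulusE_integrand h m).intervalIntegrable _ _) fun t ht => ?_
  refine mul_le_mul_of_nonneg_right ?_
    (sin_nonneg_of_nonneg_of_le_pi ht.1 (by linarith [ht.2, pi_pos]))
  rw [max_eq_left (div_nonneg (by linarith [ht.1]) hm'.le)]
  rcases ht.1.eq_or_lt with h0 | h0
  · rw [← h0]; simp [h.zero]
  · have := hN (2 * t / m) (by positivity)
      (div_le_div_of_nonneg_right (by linarith [ht.2]) hm'.le)
    refine le_trans (le_of_eq ?_) this
    ring

lemma modulusE_le_of_le_mul (h : IsModulusOfContinuity ω) {m : ℕ} (hm : 0 < m) {N : ℝ}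
    (hN : ∀ s, 0 < s → ω s ≤ N * s) : modulusE m ω ≤ 2 * N / m := by
  have hm' : (0 : ℝ) < m := by exact_mod_cast hm
  rw [modulusE_eq, ← integral_mul_sin (2 * N / m)]
  refine intervalIntegral.integral_mono_on (by positivity)
    ((continuous_modulusE_integrand h m).intervalIntegrable _ _)
    (Continuous.intervalIntegrable (by fun_prop) _ _) fun t ht => ?_
  refine mul_le_mul_of_nonneg_right ?_
    (sin_nonneg_of_nonneg_of_le_pi ht.1 (by linarith [ht.2, pi_pos]))
  rw [max_eq_left (div_nonneg (by linarith [ht.1]) hm'.le)]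
  rcases ht.1.eq_or_lt with h0 | h0
  · rw [← h0]; simp [h.zero]
  · refine (hN (2 * t / m) (by positivity)).trans (le_of_eq ?_)
    ring

variable (h0 : 0 < q) (h1 : q < 1) {p : ℕ} (hp : 0 < p)
include h0 h1 hp

lemma continuous_kernelAmp (γ : ℝ) : Continuous (kernelAmp q γ p) :=
  continuous_iff_continuousAt.2 fun t => (hasDerivAt_kernelAmp h0 h1 γ hp t).continuousAt

lemma le_constK : (1 - q) * π / 2 ≤ constK p q := by
  rw [← integral_kernelAmp h0 h1 0 hp]
  have := intervalIntegral.integral_mono_on (μ := volume) (a := 0) (b := 2 * π) (by positivity)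
    (Continuous.intervalIntegrable (by fun_prop) _ _)
    ((continuous_kernelAmp h0 h1 hp 0).intervalIntegrable _ _)
    (fun t _ => one_sub_div_four_le_kernelAmp h0 h1 0 hp t)
  rw [intervalIntegral.integral_const, smul_eq_mul] at this
  linarith

lemma constK_le : constK p q ≤ 4 * π / (1 - q) ^ 2 := by
  rw [← integral_kernelAmp h0 h1 0 hp]
  have hD : 0 < 1 - q := by linarith
  have := intervalIntegral.integral_mono_on (μ := volume) (a := 0) (b := 2 * π) (by positivity)
    ((continuous_kernelAmp h0 h1 hp 0).intervalIntegrable _ _)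
    ((continuous_const (y := 2 / (1 - q) ^ 2)).intervalIntegrable _ _)
    (fun t _ => (kernelAmp_le h0 h1 0 hp t).trans (div_le_div_of_nonneg_left (by norm_num)
      (by positivity) (pow_le_pow_of_le_one hD.le (by linarith)
        (by have := expDelta_le_three p; omega))))
  rw [intervalIntegral.integral_const, smul_eq_mul] at this
  refine this.trans (le_of_eq ?_)
  ring

lemma le_principalTerm (h : IsModulusOfContinuity ω) (n : ℕ) :
    (1 - q) / (2 * π) * modulusE (n - p + 1) ω ≤ principalTerm q ω n p := by
  unfold principalTerm
  refine mul_le_mul_of_nonneg_right ?_ (modulusE_nonneg h _)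
  rw [le_div_iff₀ (by positivity)]
  refine le_trans (le_of_eq ?_) (le_constK h0 h1 hp)
  field_simp

lemma principalTerm_le (h : IsModulusOfContinuity ω) (n : ℕ) :
    principalTerm q ω n p ≤ 4 / ((1 - q) ^ 2 * π) * modulusE (n - p + 1) ω := by
  have hD : 0 < 1 - q := by linarith
  unfold principalTerm
  refine mul_le_mul_of_nonneg_right ?_ (modulusE_nonneg h _)
  rw [div_le_iff₀ (by positivity)]
  refine (constK_le h0 h1 hp).trans (le_of_eq ?_)
  field_simp

omit hp in
lemma remainderTerm_le (hω : 0 ≤ ω π) (n p : ℕ) :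
    remainderTerm q ω n p ≤ ω π / ((1 - q) ^ 3 * ((n - p + 1 : ℕ) : ℝ)) := by
  have hD : 0 < 1 - q := by linarith
  refine div_le_div_of_nonneg_left hω (by positivity) (mul_le_mul_of_nonneg_right ?_ (by positivity))
  exact pow_le_pow_of_le_one hD.le (by linarith) (expDelta_le_three p)

omit hp in
lemma le_remainderTerm (hω : 0 ≤ ω π) (n p : ℕ) :
    ω π / ((n - p + 1 : ℕ) : ℝ) ≤ remainderTerm q ω n p := by
  have hD : 0 < 1 - q := by linarith
  refine div_le_div_of_nonneg_left hω (by positivity) ?_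
  exact mul_le_of_le_one_left (by positivity) (pow_le_one₀ hD.le (by linarith))

omit hp

/-- Up to factors depending only on q, the comparison is between e_M(ω) and ω(π)/M, uniformly in p.
Monotonicity of ω(t)/t makes the failure of divergence equivalent to a global linear bound. -/
lemma isLittleO_remainderTerm_iff (h : IsConvexUpwardModulus ω)
    (hne : ∃ t : ℝ, 0 < t ∧ ω t ≠ 0) {n p : ℕ → ℕ} (hnp : ∀ k, 0 < p k ∧ p k < n k)
    (hlim : Tendsto (fun k => n k - p k) atTop atTop) :
    ((fun k => remainderTerm q ω (n k) (p k)) =o[atTop]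
        (fun k => principalTerm q ω (n k) (p k))) ↔
      Tendsto (fun t => ω t / t) (𝓝[>] 0) atTop := by
  have hm := h.toIsModulusOfContinuity
  have hω : 0 < ω π := h.pos hne pi_pos
  have hD : 0 < 1 - q := by linarith
  have hRnn : ∀ k, 0 ≤ remainderTerm q ω (n k) (p k) := fun k =>
    le_trans (by positivity) (le_remainderTerm h0 h1 hω.le (n k) (p k))
  have hPnn : ∀ k, 0 ≤ principalTerm q ω (n k) (p k) := fun k =>
    le_trans (mul_nonneg (by positivity) (modulusE_nonneg hm _))
      (le_principalTerm h0 h1 (hnp k).1 hm (n k))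
  constructor
  · intro hO
    by_contra hT
    rw [tendsto_atTop] at hT
    push Not at hT
    obtain ⟨N, hN⟩ := hT
    -- The quotient ω(s)/s is nonincreasing, so values below N arbitrarily close to 0 bound it
    -- everywhere.
    have hbd : ∀ s, 0 < s → ω s ≤ N * s := by
      intro s hs
      obtain ⟨s', hs'1, hs'2⟩ := (hN.and_eventually (Ioo_mem_nhdsGT hs)).exists
      have h2 := h.div_le_div hs'2.1 hs'2.2.le
      rw [← div_le_iff₀ hs]
      exact h2.trans (lt_of_not_ge (by simpa using hs'1)).le
    have hN0 : 0 < N := by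
      have := hω.trans_le (hbd π pi_pos)
      exact pos_of_mul_pos_left this pi_pos.le
    -- This constant makes c times the principal term at most half of ω(π)/M, while the remainder is
    -- at least ω(π)/M.
    obtain ⟨k, hk⟩ := (hO.bound (c := ω π * π * (1 - q) ^ 2 / (16 * N)) (by positivity)).exists
    rw [Real.norm_of_nonneg (hRnn k), Real.norm_of_nonneg (hPnn k)] at hk
    have e1 := modulusE_le_of_le_mul hm (Nat.succ_pos (n k - p k)) hbd
    have e2 := principalTerm_le h0 h1 (hnp k).1 hm (n k)
    have e3 := le_remainderTerm h0 h1 hω.le (n k) (p k)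
    have hMpos : (0 : ℝ) < ((n k - p k + 1 : ℕ) : ℝ) := by positivity
    have e4 : principalTerm q ω (n k) (p k)
        ≤ 4 / ((1 - q) ^ 2 * π) * (2 * N / ((n k - p k + 1 : ℕ) : ℝ)) :=
      e2.trans (mul_le_mul_of_nonneg_left e1 (by positivity))
    have e5 := (e3.trans hk).trans (mul_le_mul_of_nonneg_left e4 (by positivity))
    have e6 : ω π * π * (1 - q) ^ 2 / (16 * N) *
        (4 / ((1 - q) ^ 2 * π) * (2 * N / ((n k - p k + 1 : ℕ) : ℝ)))
        = ω π / ((n k - p k + 1 : ℕ) : ℝ) / 2 := by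
      field_simp
      ring
    rw [e6] at e5
    have : 0 < ω π / ((n k - p k + 1 : ℕ) : ℝ) := by positivity
    linarith
  · intro hT
    rw [Asymptotics.isLittleO_iff]
    intro c hc
    -- Chosen so that c·(1-q)/(2π)·2N/M equals the upper bound ω(π)/((1-q)^3 M) of the remainder.
    set N := π * ω π / (c * (1 - q) ^ 4) with hN
    have hev := (tendsto_atTop.1 hT) N
    obtain ⟨d, hd0, hd⟩ := mem_nhdsGT_iff_exists_Ioc_subset.1 hev
    have hd0 : 0 < d := hd0
    obtain ⟨m₀, hm₀⟩ := exists_nat_gt (π / d)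
    filter_upwards [hlim.eventually_ge_atTop m₀] with k hk
    rw [Real.norm_of_nonneg (hRnn k), Real.norm_of_nonneg (hPnn k)]
    have hMpos : (0 : ℝ) < ((n k - p k + 1 : ℕ) : ℝ) := by positivity
    have hM : π / ((n k - p k + 1 : ℕ) : ℝ) ≤ d := by
      rw [div_le_iff₀ hMpos]
      rw [div_lt_iff₀ hd0] at hm₀
      have : (m₀ : ℝ) ≤ ((n k - p k + 1 : ℕ) : ℝ) := by exact_mod_cast hk.trans (Nat.le_succ _)
      nlinarith
    have e1 := le_modulusE hm (Nat.succ_pos (n k - p k)) (N := N) fun s hs hsM => by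
      have : N ≤ ω s / s := hd ⟨hs, hsM.trans hM⟩
      rwa [le_div_iff₀ hs] at this
    have e2 := le_principalTerm h0 h1 (hnp k).1 hm (n k)
    have e3 := remainderTerm_le h0 h1 hω.le (n k) (p k)
    have e4 : (1 - q) / (2 * π) * (2 * N / ((n k - p k + 1 : ℕ) : ℝ))
        ≤ principalTerm q ω (n k) (p k) :=
      (mul_le_mul_of_nonneg_left e1 (by positivity)).trans e2
    refine e3.trans (le_trans (le_of_eq ?_) (mul_le_mul_of_nonneg_left e4 hc.le))
    rw [hN]
    field_simp

end Asymptotics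

end PoissonVP

theorem theorem1 :
    -- the formula, with an absolute constant in the remainder
    (∃ C : ℝ, ∀ (q β : ℝ) (n p : ℕ) (ω : ℝ → ℝ), 0 < q → q < 1 → 0 < p → p < n →
      IsConvexUpwardModulus ω →
      deviation (poissonClass q β (classH ω)) n p ≠ ⊤ ∧
      |(deviation (poissonClass q β (classH ω)) n p).toReal
          - q ^ (n - p + 1) / p * principalTerm q ω n p|
        ≤ q ^ (n - p + 1) / p * (C * remainderTerm q ω n p)) ∧
    -- as `n - p → ∞`, the remainder is negligible with respect to the principal term
    -- if and only if `ω(t)/t → ∞`, and in that case the two sides are asymptotically equal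
    (∀ (q β : ℝ) (ω : ℝ → ℝ) (n p : ℕ → ℕ), 0 < q → q < 1 →
      IsConvexUpwardModulus ω → (∃ t : ℝ, 0 < t ∧ ω t ≠ 0) →
      (∀ k, 0 < p k ∧ p k < n k) → Tendsto (fun k => n k - p k) atTop atTop →
      (((fun k => remainderTerm q ω (n k) (p k)) =o[atTop]
          (fun k => principalTerm q ω (n k) (p k))) ↔
        Tendsto (fun t => ω t / t) (𝓝[>] 0) atTop) ∧
      (Tendsto (fun t => ω t / t) (𝓝[>] 0) atTop →
        (fun k => (deviation (poissonClass q β (classH ω)) (n k) (p k)).toReal) ~[atTop]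
          (fun k => q ^ (n k - p k + 1) / (p k : ℝ) * principalTerm q ω (n k) (p k)))) := by
  have hformula : ∀ (q β : ℝ) (n p : ℕ) (ω : ℝ → ℝ), 0 < q → q < 1 → 0 < p → p < n →
      IsConvexUpwardModulus ω → _ := fun q β n p ω h0 h1 hp hpn h =>
    deviation_poissonClass h0 h1 β hp hpn h
  refine ⟨⟨400, hformula⟩, fun q β ω n p h0 h1 h hne hnp hlim => ?_⟩
  have hiff := isLittleO_remainderTerm_iff h0 h1 h hne hnp hlim
  refine ⟨hiff, fun hT => ?_⟩
  -- The prefactor q^M/p depends on k, so it multiplies both sides of the little-o relation before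
  -- the formula is applied.
  have hO := (Asymptotics.isBigO_refl (fun k => q ^ (n k - p k + 1) / (p k : ℝ)) atTop).mul_isLittleO
    (hiff.2 hT)
  refine Asymptotics.IsBigO.trans_isLittleO (Asymptotics.IsBigO.of_bound 400 ?_) hO
  refine Eventually.of_forall fun k => ?_
  have hk := (hformula q β (n k) (p k) ω h0 h1 (hnp k).1 (hnp k).2 h).2
  refine le_trans hk (le_trans (le_of_eq ?_)
    (mul_le_mul_of_nonneg_left (le_abs_self _) (by norm_num)))
  ring
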